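/- Let $D\subset\mathbb R^d$, $d\ge 1$, be a non-empty bounded open set, $X=C(\overline D)$, and let $V=H^1_0(D)$ be the closure of $C_c^\infty(D)$ in the $H^1$ norm, $|v|_{H^1(D)}=\|\nabla v\|_{L^2(D)}$. Let $m_0,\phi_1,\phi_2,\dots\in X$, $\gamma_1,\gamma_2,\dots\in\mathbb R$, let $\xi=(\xi_j)_{j\ge1}$ be i.i.d. with law $\mathbb P$ on $\mathbb R^\infty$, and let $u(\cdot;\xi)=m_0+\sum_{j=1}^\infty\gamma_j\xi_j\phi_j$. Assume one of the following. * (Uniform prior) $\xi_1\sim U[-1,1]$, $\|\phi_j\|_{C(\overline D)}=1$ for all $j$, and $\sum_j|\gamma_j|<m_{\min}\le m_0(x)$ for all $x\in\overline D$ and some constant $m_{\min}$; the coefficient is $k(\cdot;\xi)=u(\cdot;\xi)$. * (Gaussian prior) $\xi_1\sim N(0,1)$, the series for $u(\cdot;\xi)$ converges in $X$ for $\mathbb P$-almost every $\xi$, and $k(\cdot;\xi)=k^*+\exp(u(\cdot;\xi))$ with a given $k^*\in C(\overline D)$, $k^*\ge0$. Let $f\in H^{-1}(D)$. For a conforming simplicial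 triangulation $\mathcal T_h$ of $\overline D$ with finitely many simplices and mesh width $h$, let $V_h\subset H^1_0(D)$ be the space of continuous functions on $\overline D$ that are affine on each simplex and vanish on $\partial D$, and let $p_h(\cdot;\xi)\in V_h$ be the finite element solution, $$\int_D k(x;\xi)\,\nabla p_h\cdot\nabla q_h\,dx=\langle f,q_h\rangle\qquad\text{for all }q_h\in V_h .$$ Let $\phi:V\to\mathbb R$ and $\mathcal H:V\to\mathbb R^m$ be Borel measurable and of polynomial growth: there are $M_1,M_2>0$ and $n_1,n_2\in\mathbb N$ with $$|\phi(v)|\le M_1\bigl(1+|v|_{H^1(D)}^{n_1}\bigr),\qquad |\mathcal H(v)|\le M_2\bigl(1+|v|_{H^1(D)}^{n_2}\bigr)\qquad\text{for all }v\in V.$$ Let $y\in\mathbb R^m$, $\sigma_\eta^2>0$, $\theta(v)=\exp\bigl(-\tfrac1{2\sigma_\eta^2}|y-\mathcal H(v)|^2\bigr)$ and $\psi=\theta\phi$. For $N\ge1$ and i.i.d. samples $\xi^{(1)},\dots,\xi^{(N)}$ from $\mathbb P$, defined on an arbitrary probability space, let $$\widehat Q_{h,N}=\frac1N\sum_{i=1}^N\psi\bigl(p_h(\cdot;\xi^{(i)})\bigr),\qquad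 \widehat Z_{h,N}=\frac1N\sum_{i=1}^N\theta\bigl(p_h(\cdot;\xi^{(i)})\bigr),$$ with the same samples in both. Then, for every $1\le r<\infty$, there is a finite constant $C$, independent of the triangulation $\mathcal T_h$ (in particular of $h$), of $N$ and of the probability space and samples, such that $$\widehat Q_{h,N}\big/\widehat Z_{h,N}\in L^r\qquad\text{and}\qquad \bigl\|\widehat Q_{h,N}\big/\widehat Z_{h,N}\bigr\|_{L^r}\le C .$$ -/

import Mathlib

open MeasureTheory ProbabilityTheory Filter Topology
open scoped ENNReal

noncomputable section

namespace RatioMC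

/-- Euclidean space `ℝᵈ`. -/
abbrev Space (d : ℕ) : Type := EuclideanSpace ℝ (Fin d)

/-- A non-empty bounded open set `D ⊂ ℝᵈ`, the spatial domain. -/
structure BoundedDomain (d : ℕ) where
  /-- the underlying set `D` -/
  carrier : Set (Space d)
  isOpen : IsOpen carrier
  isBounded : Bornology.IsBounded carrier
  nonempty : carrier.Nonempty

variable {d : ℕ}

/-- The closure `D̄` of the domain. -/
abbrev BoundedDomain.cl (D : BoundedDomain d) : Set (Space d) := closure D.carrier

instance (D : BoundedDomain d) : CompactSpace D.cl :=
  isCompact_iff_compactSpace.1 D.isBounded.isCompact_closure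

/-- Lebesgue measure on `D`. -/
abbrev BoundedDomain.vol (D : BoundedDomain d) : Measure (Space d) :=
  volume.restrict D.carrier

/-- The space `X = C(D̄)`, with the supremum norm. -/
abbrev CField (D : BoundedDomain d) : Type := C(D.cl, ℝ)

/-! ### The Sobolev space `H¹₀(D)` -/

/-- The Hilbert space `L²(D) × L²(D; ℝᵈ)` of pairs (function, gradient). Its norm is
`(‖v‖² + ‖g‖²)^(1/2)`, which is the `H¹` norm on pairs `(v, ∇v)`. -/
abbrev L2Pair (D : BoundedDomain d) : Type :=
  WithLp 2 (Lp ℝ 2 D.vol × Lp (Space d) 2 D.vol)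

/-- The pairs `(v, ∇v)` with `v ∈ C_c^∞(D)`. -/
def testPairs (D : BoundedDomain d) : Set (L2Pair D) :=
  {w | ∃ v : Space d → ℝ, ContDiff ℝ (⊤ : ℕ∞) v ∧ HasCompactSupport v ∧ tsupport v ⊆ D.carrier ∧
    (w.fst : Space d → ℝ) =ᵐ[D.vol] v ∧ (w.snd : Space d → Space d) =ᵐ[D.vol] gradient v}

/-- `H¹₀(D)`, the closure of `C_c^∞(D)` in the `H¹` norm; an element is stored together with its
weak gradient. (The set `testPairs D` is itself a linear subspace.) -/
def H10Submodule (D : BoundedDomain d) : Submodule ℝ (L2Pair D) :=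
  (Submodule.span ℝ (testPairs D)).topologicalClosure

/-- The Hilbert space `V = H¹₀(D)`, with the full `H¹` norm. -/
abbrev H10 (D : BoundedDomain d) : Type := H10Submodule D

/-- The function underlying an element of `H¹₀(D)`. -/
def H10.val {D : BoundedDomain d} (v : H10 D) : Lp ℝ 2 D.vol := (v : L2Pair D).fst

/-- The weak gradient of an element of `H¹₀(D)`. -/
def H10.grad {D : BoundedDomain d} (v : H10 D) : Lp (Space d) 2 D.vol := (v : L2Pair D).snd

/-- The seminorm `|v|_{H¹(D)} = ‖∇v‖_{L²(D)}`. -/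
def H10.semi {D : BoundedDomain d} (v : H10 D) : ℝ := ‖v.grad‖

/-! ### The elliptic problem and its finite element approximation -/

/-- The function `k ∈ C(D̄)` as a function on `ℝᵈ`, extended by zero. -/
def CField.toFun' {D : BoundedDomain d} (k : CField D) : Space d → ℝ :=
  Function.extend (Subtype.val : D.cl → Space d) k 0

/-- The bilinear form `b(v, w) = ∫_D k ∇v · ∇w dx` with coefficient `k`. -/
def bilin {D : BoundedDomain d} (k : CField D) (v w : H10 D) : ℝ :=
  ∫ x in D.carrier, CField.toFun' k x *
    inner ℝ ((v.grad : Space d → Space d) x) ((w.grad : Space d → Space d) x)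

/-- A conforming simplicial triangulation of `D`: a finite simplicial complex whose underlying
space is `D̄`. (As `D` is open, each simplex is a face of a `d`-dimensional one.) -/
structure Triangulation (D : BoundedDomain d) where
  /-- the simplicial complex -/
  complex : Geometry.SimplicialComplex ℝ (Space d)
  finite : complex.faces.Finite
  space_eq : complex.space = D.cl

/-- `q` is a continuous, piecewise linear function on `D̄` that vanishes on `∂D`. -/
structure IsPiecewiseLinear {D : BoundedDomain d} (T : Triangulation D) (q : Space d → ℝ) :
    Prop where
  continuousOn : ContinuousOn q D.cl
  affine_on : ∀ s ∈ T.complex.faces, ∃ A : Space d →ᵃ[ℝ] ℝ,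
    Set.EqOn q A (convexHull ℝ (s : Set (Space d)))
  zero_on : ∀ x ∈ frontier D.carrier, q x = 0

/-- The finite element space `V_h ⊂ H¹₀(D)` of continuous, piecewise linear functions with respect
to the triangulation that vanish on `∂D`. -/
def feSpace {D : BoundedDomain d} (T : Triangulation D) : Submodule ℝ (H10 D) where
  carrier := {v | ∃ q, IsPiecewiseLinear T q ∧ (v.val : Space d → ℝ) =ᵐ[D.vol] q}
  zero_mem' := by
    refine ⟨0, ⟨continuousOn_const, fun s _ => ⟨0, fun x _ => by simp⟩, fun x _ => rfl⟩, ?_⟩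
    exact Lp.coeFn_zero ℝ 2 D.vol
  add_mem' := by
    rintro v w ⟨p, hp, hvp⟩ ⟨q, hq, hwq⟩
    refine ⟨p + q, ⟨hp.continuousOn.add hq.continuousOn, fun s hs => ?_, fun x hx => ?_⟩, ?_⟩
    · obtain ⟨A, hA⟩ := hp.affine_on s hs
      obtain ⟨B, hB⟩ := hq.affine_on s hs
      exact ⟨A + B, fun x hx => by simp [hA hx, hB hx]⟩
    · simp [hp.zero_on x hx, hq.zero_on x hx]
    · exact (Lp.coeFn_add v.val w.val).trans (hvp.add hwq)
  smul_mem' := by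
    rintro c v ⟨p, hp, hvp⟩
    refine ⟨c • p, ⟨hp.continuousOn.const_smul c, fun s hs => ?_, fun x hx => ?_⟩, ?_⟩
    · obtain ⟨A, hA⟩ := hp.affine_on s hs
      exact ⟨c • A, fun x hx => by simp [hA hx]⟩
    · simp [hp.zero_on x hx]
    · exact (Lp.coeFn_smul c v.val).trans (hvp.const_smul c)

/-- `p` solves the finite element problem with coefficient `k` and right-hand side
`f ∈ H⁻¹(D) = H¹₀(D)'`: `p ∈ V_h` and `b(p, q) = ⟨f, q⟩` for all `q ∈ V_h`. -/
def IsFESolution {D : BoundedDomain d} (T : Triangulation D) (f : H10 D →L[ℝ] ℝ) (k : CField D)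
    (p : H10 D) : Prop :=
  p ∈ feSpace T ∧ ∀ q ∈ feSpace T, bilin k p q = f q

open Classical in
/-- The finite element solution `p_h` with coefficient `k`. It exists and is unique when `k > 0`
on `D̄`; the value `0` for coefficients without a solution is a convention. -/
def feSolution {D : BoundedDomain d} (T : Triangulation D) (f : H10 D →L[ℝ] ℝ) (k : CField D) :
    H10 D :=
  if h : ∃ p, IsFESolution T f k p then h.choose else 0

/-! ### The prior -/

/-- The uniform distribution on `[-1, 1]`. -/
def uniformLaw : Measure ℝ := (2 : ℝ≥0∞)⁻¹ • volume.restrict (Set.Icc (-1 : ℝ) 1)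

instance : IsProbabilityMeasure uniformLaw := ⟨by
  simp only [uniformLaw, Measure.smul_apply, Measure.restrict_apply_univ, Real.volume_Icc,
    smul_eq_mul]
  norm_num
  exact ENNReal.inv_mul_cancel (by simp) (by simp)⟩

/-- The two kinds of prior: uniform, and Gaussian with a continuous function `k*`. -/
inductive PriorKind (D : BoundedDomain d) where
  | uniform : PriorKind D
  | gaussian (kstar : CField D) : PriorKind D

/-- The law of one coefficient `ξ_j`: `U[-1, 1]` or `N(0, 1)`. -/
def PriorKind.coordLaw {D : BoundedDomain d} : PriorKind D → Measure ℝ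
  | .uniform => uniformLaw
  | .gaussian _ => gaussianReal 0 1

instance {D : BoundedDomain d} (K : PriorKind D) : IsProbabilityMeasure K.coordLaw := by
  cases K
  · exact inferInstanceAs (IsProbabilityMeasure uniformLaw)
  · exact inferInstanceAs (IsProbabilityMeasure (gaussianReal 0 1))

/-- The data of the random field `u = m₀ + ∑ⱼ γⱼ ξⱼ φⱼ` with values in `X = C(D̄)`, and of the
diffusion coefficient built from it. -/
structure Prior (D : BoundedDomain d) where
  kind : PriorKind D
  /-- the mean `m₀` -/
  mean : CField D
  /-- the functions `φⱼ` -/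
  basis : ℕ → CField D
  /-- the weights `γⱼ` -/
  weight : ℕ → ℝ

/-- The measure `ℙ` on the coefficient space `ℝ^∞`, with the product `σ`-algebra. -/
def Prior.law {D : BoundedDomain d} (S : Prior D) : Measure (ℕ → ℝ) :=
  Measure.infinitePi fun _ : ℕ => S.kind.coordLaw

/-- The partial sums of the series that defines `u`. -/
def Prior.partialSum {D : BoundedDomain d} (S : Prior D) (ξ : ℕ → ℝ) (n : ℕ) : CField D :=
  S.mean + ∑ j ∈ Finset.range n, (S.weight j * ξ j) • S.basis j

/-- The field `u(· ; ξ)`, the sum of the series in `C(D̄)` (a convention applies to those `ξ` for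
which the series does not converge). -/
def Prior.field {D : BoundedDomain d} (S : Prior D) (ξ : ℕ → ℝ) : CField D :=
  limUnder atTop (S.partialSum ξ)

/-- The diffusion coefficient: `k = u` for uniform priors, `k = k* + exp(u)` for Gaussian ones. -/
def Prior.coeff {D : BoundedDomain d} (S : Prior D) (ξ : ℕ → ℝ) : CField D :=
  match S.kind with
  | .uniform => S.field ξ
  | .gaussian kstar => kstar + ⟨fun x => Real.exp (S.field ξ x), by fun_prop⟩

/-- The standing assumptions on the prior.

Uniform case: the `φⱼ` are normalised, `γ ∈ ℓ¹`, and `‖γ‖_{ℓ¹} < m_min ≤ m₀` for some constant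
`m_min` (so `‖γ‖_{ℓ¹} = r m_min / (1 + r)` with some finite `r ≥ 0`).

Gaussian case: `k* ≥ 0`, and the series converges in `X = C(D̄)` for `ℙ`-almost every `ξ`, so that
it does define a random element of `X`. -/
def Prior.Admissible {D : BoundedDomain d} (S : Prior D) : Prop :=
  match S.kind with
  | .uniform => (∀ j, ‖S.basis j‖ = 1) ∧ Summable (fun j => |S.weight j|) ∧
      ∃ mmin : ℝ, (∀ x, mmin ≤ S.mean x) ∧ ∑' j, |S.weight j| < mmin
  | .gaussian kstar => (∀ x, 0 ≤ kstar x) ∧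
      ∀ᵐ ξ ∂S.law, ∃ u : CField D, Tendsto (S.partialSum ξ) atTop (𝓝 u)

/-! ### The estimators -/

/-- The likelihood `θ(ζ) = exp(-|y - H(ζ)|² / (2 σ²))`; the argument `s` stands for `σ²`. -/
def likelihood {D : BoundedDomain d} {m : ℕ} (H : H10 D → EuclideanSpace ℝ (Fin m))
    (y : EuclideanSpace ℝ (Fin m)) (s : ℝ) (v : H10 D) : ℝ :=
  Real.exp (-(1 / (2 * s) * ‖y - H v‖ ^ 2))

/-- The Monte Carlo estimator `(1/N) ∑ᵢ F(p_h(· ; ξ⁽ⁱ⁾))` for the samples `ξ⁽¹⁾, …, ξ⁽ᴺ⁾`. -/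
def mcEstimator {D : BoundedDomain d} (S : Prior D) (f : H10 D →L[ℝ] ℝ) (T : Triangulation D)
    (F : H10 D → ℝ) {N : ℕ} (samples : Fin N → ℕ → ℝ) : ℝ :=
  1 / (N : ℝ) * ∑ i, F (feSolution T f (S.coeff (samples i)))

/-- The estimator of `Z`. -/
def zHat {D : BoundedDomain d} (S : Prior D) (f : H10 D →L[ℝ] ℝ) (T : Triangulation D) {m : ℕ}
    (H : H10 D → EuclideanSpace ℝ (Fin m)) (y : EuclideanSpace ℝ (Fin m)) (s : ℝ)
    {N : ℕ} (samples : Fin N → ℕ → ℝ) : ℝ :=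
  mcEstimator S f T (likelihood H y s) samples

/-- The estimator of `Q`, with `ψ = θ φ`. -/
def qHat {D : BoundedDomain d} (S : Prior D) (f : H10 D →L[ℝ] ℝ) (T : Triangulation D) {m : ℕ}
    (H : H10 D → EuclideanSpace ℝ (Fin m)) (y : EuclideanSpace ℝ (Fin m)) (s : ℝ)
    (φ : H10 D → ℝ) {N : ℕ} (samples : Fin N → ℕ → ℝ) : ℝ :=
  mcEstimator S f T (fun v => likelihood H y s v * φ v) samples

/-- Polynomial growth of a functional on `H¹₀(D)`: `‖F(v)‖ ≤ M (1 + |v|ⁿ_{H¹(D)})`. -/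
def PolyGrowth {D : BoundedDomain d} {E : Type*} [Norm E] (F : H10 D → E) : Prop :=
  ∃ M : ℝ, 0 < M ∧ ∃ n : ℕ, ∀ v, ‖F v‖ ≤ M * (1 + v.semi ^ n)

end RatioMC

end

open RatioMC

noncomputable section

namespace RatioMC

variable {d : ℕ} {D : BoundedDomain d}

/-! ### The energy form -/

/-! No uniform positive lower bound is available for the denominator, so numerator and denominator
are not estimated separately. With `θᵢ`, `φᵢ` the values at sample `i`, the ratio is a weighted mean
of the `φᵢ` with weights `θᵢ / ∑ⱼ θⱼ`, and Jensen's inequality bounds its `r`-th power by the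
weighted mean of `|φᵢ|^r`. Fix `δ ≤ 1` such that `θ ≥ δ` has probability at least `1/2`. Since `θ ≤
1`, the `i`-th weight is at most `δ⁻¹ cᵢ`, where `cᵢ = 1 / (1 + #{j ≠ i : θⱼ ≥ δ})` is independent
of sample `i` (`weight_le`). The sum of the `cᵢ` over the indices with `θᵢ ≥ δ` is at most `1`; by
independence its expectation is at least `(1/2) ∑ᵢ E cᵢ`, so `∑ᵢ E cᵢ ≤ 2`. Hence `E |ratio|^r ≤ 2
δ⁻¹ E |φ|^r` for every `N` (`lintegral_ratio_rpow_le`). It remains to choose `δ` and bound `E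
|φ(p_h)|^r` independently of the triangulation (`exists_uniform_bounds`). Poincaré and coercivity
give `|p_h| ≤ A / min k` with `A` depending only on `f` and `D`, and `min k ≥ exp (-τ)` where `τ`
has all exponential moments: it is constant for uniform priors, and `‖u‖` for Gaussian ones, where
Fernique's theorem applies (`Prior.exists_coeff_bounds`). Polynomial growth and Markov's inequality
then suffice. Measurability of the samples comes from continuous dependence of `p_h` on the
coefficient. -/

lemma CField.toFun'_apply (k : CField D) {x : Space d} (hx : x ∈ D.carrier) :
    CField.toFun' k x = k ⟨x, subset_closure hx⟩ :=
  Subtype.val_injective.extend_apply _ _ (⟨x, subset_closure hx⟩ : D.cl)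

lemma CField.aestronglyMeasurable_toFun' (k : CField D) :
    AEStronglyMeasurable (CField.toFun' k) D.vol := by
  refine ContinuousOn.aestronglyMeasurable ?_ D.isOpen.measurableSet
  rw [continuousOn_iff_continuous_domRestrict]
  have : D.carrier.domRestrict (CField.toFun' k)
      = fun x : D.carrier => k ⟨x, subset_closure x.2⟩ := by
    ext x; exact CField.toFun'_apply k x.2
  rw [this]
  fun_prop

lemma CField.ae_norm_toFun'_le (k : CField D) : ∀ᵐ x ∂D.vol, ‖CField.toFun' k x‖ ≤ ‖k‖ := by
  filter_upwards [ae_restrict_mem D.isOpen.measurableSet] with x hx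
  rw [CField.toFun'_apply k hx]
  exact k.norm_coe_le_norm _

lemma integrable_bilin (k : CField D) (v w : H10 D) :
    Integrable (fun x => CField.toFun' k x *
      inner ℝ ((v.grad : Space d → Space d) x) ((w.grad : Space d → Space d) x)) D.vol :=
  (L2.integrable_inner (𝕜 := ℝ) v.grad w.grad).bdd_mul k.aestronglyMeasurable_toFun'
    k.ae_norm_toFun'_le

lemma H10.grad_add (v w : H10 D) : (v + w).grad = v.grad + w.grad := rfl
lemma H10.grad_smul (c : ℝ) (v : H10 D) : (c • v).grad = c • v.grad := rfl
lemma H10.semi_nonneg (v : H10 D) : 0 ≤ v.semi := norm_nonneg _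

lemma H10.norm_sq (v : H10 D) : ‖v‖ ^ 2 = ‖v.val‖ ^ 2 + v.semi ^ 2 :=
  WithLp.prod_norm_sq_eq_of_L2 (v : L2Pair D)

lemma H10.semi_le_norm (v : H10 D) : v.semi ≤ ‖v‖ := by
  refine abs_le_of_sq_le_sq' ?_ (norm_nonneg _) |>.2
  rw [H10.norm_sq]
  nlinarith [sq_nonneg ‖v.val‖]

lemma bilin_comm (k : CField D) (v w : H10 D) : bilin k v w = bilin k w v := by
  simp only [bilin, real_inner_comm]

lemma bilin_add_left (k : CField D) (u v w : H10 D) :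
    bilin k (u + v) w = bilin k u w + bilin k v w := by
  rw [bilin, bilin, bilin, ← integral_add (integrable_bilin k u w) (integrable_bilin k v w)]
  refine integral_congr_ae ?_
  rw [H10.grad_add]
  filter_upwards [Lp.coeFn_add u.grad v.grad] with x hx
  simp only [hx, Pi.add_apply, inner_add_left, mul_add]

lemma bilin_smul_left (k : CField D) (c : ℝ) (v w : H10 D) :
    bilin k (c • v) w = c * bilin k v w := by
  rw [bilin, bilin, ← integral_const_mul]
  refine integral_congr_ae ?_
  rw [H10.grad_smul]
  filter_upwards [Lp.coeFn_smul c v.grad] with x hx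
  simp only [hx, Pi.smul_apply, real_inner_smul_left]
  ring

lemma bilin_sub_left (k : CField D) (u v w : H10 D) :
    bilin k (u - v) w = bilin k u w - bilin k v w := by
  rw [sub_eq_add_neg, ← neg_one_smul ℝ v, bilin_add_left, bilin_smul_left]
  ring

lemma bilin_coeff_sub (k l : CField D) (v w : H10 D) :
    bilin (k - l) v w = bilin k v w - bilin l v w := by
  rw [bilin, bilin, bilin, ← integral_sub (integrable_bilin k v w) (integrable_bilin l v w)]
  refine setIntegral_congr_fun D.isOpen.measurableSet fun x hx => ?_
  simp only [CField.toFun'_apply _ hx, ContinuousMap.sub_apply, sub_mul]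

/-- Cauchy–Schwarz in the real space `L²`, applied to the classes of `‖f‖` and `‖g‖`. -/
lemma integral_norm_mul_norm_le {α E : Type*} [MeasurableSpace α] {μ : Measure α}
    [NormedAddCommGroup E] (f g : Lp E 2 μ) :
    Integrable (fun x => ‖f x‖ * ‖g x‖) μ ∧ ∫ x, ‖f x‖ * ‖g x‖ ∂μ ≤ ‖f‖ * ‖g‖ := by
  set f' : Lp ℝ 2 μ := (Lp.memLp f).norm.toLp _
  set g' : Lp ℝ 2 μ := (Lp.memLp g).norm.toLp _
  have hf : ‖f'‖ = ‖f‖ := by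
    rw [Lp.norm_toLp, eLpNorm_norm, Lp.norm_def]
  have hg : ‖g'‖ = ‖g‖ := by
    rw [Lp.norm_toLp, eLpNorm_norm, Lp.norm_def]
  have h : (fun x => inner ℝ (f' x) (g' x)) =ᵐ[μ] fun x => ‖f x‖ * ‖g x‖ := by
    filter_upwards [(Lp.memLp f).norm.coeFn_toLp, (Lp.memLp g).norm.coeFn_toLp] with x hx hy
    simp only [f', g', hx, hy]
    simp [mul_comm]
  refine ⟨(L2.integrable_inner (𝕜 := ℝ) f' g').congr h, ?_⟩
  rw [← integral_congr_ae h, ← L2.inner_def, ← hf, ← hg]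
  exact real_inner_le_norm _ _

lemma abs_bilin_le (k : CField D) (v w : H10 D) : |bilin k v w| ≤ ‖k‖ * v.semi * w.semi := by
  obtain ⟨hi, hle⟩ := integral_norm_mul_norm_le v.grad w.grad
  calc |bilin k v w|
      ≤ ∫ x in D.carrier, ‖k‖ * (‖(v.grad : Space d → Space d) x‖ *
          ‖(w.grad : Space d → Space d) x‖) := by
        rw [bilin, ← Real.norm_eq_abs]
        refine norm_integral_le_of_norm_le (hi.const_mul _) ?_
        filter_upwards [k.ae_norm_toFun'_le] with x hx
        rw [norm_mul]
        exact mul_le_mul hx (norm_inner_le_norm _ _) (norm_nonneg _) (norm_nonneg _)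
    _ ≤ ‖k‖ * v.semi * w.semi := by
        rw [integral_const_mul, mul_assoc]
        exact mul_le_mul_of_nonneg_left hle (norm_nonneg _)

lemma le_bilin_self {k : CField D} {c : ℝ} (hk : ∀ x, c ≤ k x) (v : H10 D) :
    c * v.semi ^ 2 ≤ bilin k v v := by
  have : v.semi ^ 2 = ∫ x in D.carrier,
      inner ℝ ((v.grad : Space d → Space d) x) ((v.grad : Space d → Space d) x) := by
    rw [← L2.inner_def (𝕜 := ℝ) v.grad v.grad, real_inner_self_eq_norm_sq]; rfl
  rw [this, bilin, ← integral_const_mul]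
  refine setIntegral_mono_on ((L2.integrable_inner (𝕜 := ℝ) v.grad v.grad).const_mul c)
    (integrable_bilin k v v) D.isOpen.measurableSet fun x hx => ?_
  rw [CField.toFun'_apply k hx]
  exact mul_le_mul_of_nonneg_right (hk _) real_inner_self_nonneg

/-! ### The Poincaré inequality -/

/-- As `∂ᵢ xᵢ = 1`, integration by parts gives `∫ v² = -∫ 2 v (∂ᵢ v) xᵢ`, and `|xᵢ| ≤ R` on the
support of `v`. -/
lemma poincare_smooth {R : ℝ} {K : Set (Space d)} (hR : ∀ x ∈ K, ‖x‖ ≤ R) (i : Fin d)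
    {v : Space d → ℝ} (hv : ContDiff ℝ (⊤ : ℕ∞) v) (hc : HasCompactSupport v)
    (hK : tsupport v ⊆ K) :
    ∫ x, v x ^ 2 ≤ 4 * R ^ 2 * ∫ x, ‖gradient v x‖ ^ 2 := by
  have hv1 : ContDiff ℝ 1 v := hv.of_le (by exact_mod_cast le_top)
  have hvd : Differentiable ℝ v := hv1.differentiable one_ne_zero
  have hcont : Continuous v := hv1.continuous
  have hdc : Continuous (fderiv ℝ v) := hv1.continuous_fderiv one_ne_zero
  set e : Space d := EuclideanSpace.single i 1
  set g : Space d →L[ℝ] ℝ := EuclideanSpace.proj i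
  have hge : g e = 1 := by simp [g, e]
  have hgle : ∀ x, |g x| ≤ ‖x‖ := fun x => by simpa [g] using PiLp.norm_apply_le x i
  have hdv : ∀ x, fderiv ℝ (fun y => v y ^ 2) x e = 2 * v x * fderiv ℝ v x e := fun x => by
    rw [fderiv_fun_pow 2 (hvd x)]; simp
  have hsupp2 : HasCompactSupport (fun x => v x ^ 2) :=
    hc.comp_left (g := fun t : ℝ => t ^ 2) (by simp)
  have hi1 : Integrable (fun x => 2 * v x * fderiv ℝ v x e * g x) := by
    refine Continuous.integrable_of_hasCompactSupport (by fun_prop) ?_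
    exact ((hc.mul_left (f := fun _ => (2 : ℝ))).mul_right).mul_right
  have hi2 : Integrable (fun x => v x ^ 2) :=
    Continuous.integrable_of_hasCompactSupport (by fun_prop) hsupp2
  have hi3 : Integrable (fun x => v x ^ 2 * g x) :=
    Continuous.integrable_of_hasCompactSupport (by fun_prop) hsupp2.mul_right
  have hgrad : ∀ x, ‖gradient v x‖ = ‖fderiv ℝ v x‖ := fun x => by
    simp [gradient]
  have hi4 : Integrable (fun x => ‖gradient v x‖ ^ 2) := by
    simp only [hgrad]
    refine Continuous.integrable_of_hasCompactSupport (by fun_prop) ?_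
    exact (hc.fderiv (𝕜 := ℝ)).comp_left (g := fun t => ‖t‖ ^ 2) (by simp)
  have key := integral_mul_fderiv_eq_neg_fderiv_mul_of_integrable (μ := (volume : Measure (Space d)))
    (f := fun x => v x ^ 2) (g := g) (v := e)
    (by simpa only [hdv] using hi1)
    (by simpa only [ContinuousLinearMap.fderiv, hge, mul_one] using hi2) hi3
    (fun x _ => (hvd x).pow 2) (fun x _ => g.differentiableAt)
  simp only [ContinuousLinearMap.fderiv, hge, mul_one, hdv] at key
  -- Young's inequality `-2vz ≤ v²/2 + 2z²` with `z = xᵢ ∂ᵢ v`, weighted so that half of `∫ v²` can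
  -- be absorbed on the left.
  have hpt : ∀ x, -(2 * v x * fderiv ℝ v x e * g x)
      ≤ 2⁻¹ * v x ^ 2 + 2 * R ^ 2 * ‖gradient v x‖ ^ 2 := fun x => by
    by_cases hx : x ∈ tsupport v
    · have h1 : |fderiv ℝ v x e| ≤ ‖gradient v x‖ := by
        rw [hgrad]
        simpa [e] using (fderiv ℝ v x).le_opNorm e
      have h2 : |g x| ≤ R := (hgle x).trans (hR x (hK hx))
      have h3 : |fderiv ℝ v x e * g x| ≤ ‖gradient v x‖ * R := by
        rw [abs_mul]; exact mul_le_mul h1 h2 (abs_nonneg _) (norm_nonneg _)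
      have h4 : (fderiv ℝ v x e * g x) ^ 2 ≤ (‖gradient v x‖ * R) ^ 2 := by
        rw [← sq_abs]; exact pow_le_pow_left₀ (abs_nonneg _) h3 2
      nlinarith [sq_nonneg (v x + 2 * (fderiv ℝ v x e * g x))]
    · rw [image_eq_zero_of_notMem_tsupport hx]
      simp only [mul_zero, zero_mul, neg_zero]
      positivity
  have hint : ∫ x, v x ^ 2 ≤ 2⁻¹ * (∫ x, v x ^ 2) + 2 * R ^ 2 * ∫ x, ‖gradient v x‖ ^ 2 := by
    calc ∫ x, v x ^ 2 = ∫ x, -(2 * v x * fderiv ℝ v x e * g x) := by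
          rw [key, integral_neg]
      _ ≤ ∫ x, (2⁻¹ * v x ^ 2 + 2 * R ^ 2 * ‖gradient v x‖ ^ 2) :=
          integral_mono hi1.neg ((hi2.const_mul _).add (hi4.const_mul _)) hpt
      _ = _ := by
          rw [integral_add (hi2.const_mul _) (hi4.const_mul _), integral_const_mul,
            integral_const_mul]
  linarith

lemma L2_norm_sq_eq_integral {E : Type*} [NormedAddCommGroup E] [InnerProductSpace ℝ E]
    {α : Type*} [MeasurableSpace α] {μ : Measure α} (f : Lp E 2 μ) {g : α → E} (h : f =ᵐ[μ] g) :
    ‖f‖ ^ 2 = ∫ x, ‖g x‖ ^ 2 ∂μ := by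
  rw [← real_inner_self_eq_norm_sq, L2.inner_def]
  refine integral_congr_ae ?_
  filter_upwards [h] with x hx
  rw [hx, real_inner_self_eq_norm_sq]

lemma poincare_testPairs (hd : 1 ≤ d) (D : BoundedDomain d) :
    ∃ K : ℝ, 0 ≤ K ∧ ∀ w ∈ testPairs D, ‖w.fst‖ ≤ K * ‖w.snd‖ := by
  obtain ⟨R, hR0, hR⟩ := D.isBounded.exists_pos_norm_le
  refine ⟨2 * R, by positivity, ?_⟩
  rintro w ⟨v, hv, hc, hs, h1, h2⟩
  refine (abs_le_of_sq_le_sq' ?_ (by positivity)).2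
  have hz : ∀ x ∉ D.carrier, v x = 0 := fun x hx =>
    image_eq_zero_of_notMem_tsupport fun h => hx (hs h)
  have hz' : ∀ x ∉ D.carrier, gradient v x = 0 := fun x hx => by
    have : fderiv ℝ v x = 0 :=
      image_eq_zero_of_notMem_tsupport fun h => hx (hs (tsupport_fderiv_subset ℝ h))
    simp [gradient, this]
  rw [mul_pow, L2_norm_sq_eq_integral _ h1, L2_norm_sq_eq_integral _ h2,
    setIntegral_eq_integral_of_forall_compl_eq_zero fun x hx => by simp [hz x hx],
    setIntegral_eq_integral_of_forall_compl_eq_zero fun x hx => by simp [hz' x hx]]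
  simp only [Real.norm_eq_abs, sq_abs]
  rw [show (2 * R) ^ 2 = 4 * R ^ 2 by ring]
  exact poincare_smooth hR ⟨0, hd⟩ hv hc hs

/-- An inequality between norms of the two components need not survive linear combinations, so the
passage to `H¹₀(D)` requires its dense subspace to consist of test pairs only. -/
lemma span_testPairs (D : BoundedDomain d) :
    (Submodule.span ℝ (testPairs D) : Set (L2Pair D)) = testPairs D := by
  let P : Submodule ℝ (L2Pair D) :=
    { carrier := testPairs D
      zero_mem' := by
        refine ⟨0, contDiff_const, HasCompactSupport.zero, by simp [tsupport], ?_, ?_⟩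
        · exact Lp.coeFn_zero ℝ 2 D.vol
        · refine (Lp.coeFn_zero (Space d) 2 D.vol).trans (.of_forall fun x => ?_)
          simp [gradient]
      add_mem' := by
        rintro a b ⟨v, hv, hvc, hvs, hv1, hv2⟩ ⟨w, hw, hwc, hws, hw1, hw2⟩
        refine ⟨v + w, hv.add hw, hvc.add hwc,
          (tsupport_add v w).trans (Set.union_subset hvs hws), ?_, ?_⟩
        · exact (Lp.coeFn_add a.fst b.fst).trans (hv1.add hw1)
        · refine (Lp.coeFn_add a.snd b.snd).trans ((hv2.add hw2).trans (.of_forall fun x => ?_))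
          simp only [gradient, Pi.add_apply]
          rw [fderiv_add (hv.differentiable (by simp) x) (hw.differentiable (by simp) x), map_add]
      smul_mem' := by
        rintro c a ⟨v, hv, hvc, hvs, hv1, hv2⟩
        refine ⟨c • v, contDiff_const.smul hv, hvc.smul_left (f := fun _ => c),
          (tsupport_smul_subset_right (fun _ => c) v).trans hvs, ?_, ?_⟩
        · exact (Lp.coeFn_smul c a.fst).trans (hv1.const_smul c)
        · refine (Lp.coeFn_smul c a.snd).trans ((hv2.const_smul c).trans (.of_forall fun x => ?_))
          simp only [gradient, Pi.smul_apply]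
          rw [fderiv_const_smul (hv.differentiable (by simp) x), map_smul] }
  exact congrArg (fun Q : Submodule ℝ (L2Pair D) => (Q : Set (L2Pair D))) (Submodule.span_eq P)

/-- **Poincaré inequality** on `H¹₀(D)`: the seminorm controls the full norm. -/
lemma poincare (hd : 1 ≤ d) (D : BoundedDomain d) :
    ∃ K : ℝ, 0 < K ∧ ∀ v : H10 D, ‖v‖ ≤ K * v.semi := by
  obtain ⟨K, hK0, hK⟩ := poincare_testPairs hd D
  refine ⟨K + 1, by positivity, fun v => ?_⟩
  have hmem : (v : L2Pair D) ∈ closure (testPairs D) := by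
    rw [← span_testPairs, ← Submodule.topologicalClosure_coe]
    exact v.2
  have hcl : IsClosed {w : L2Pair D | ‖w.fst‖ ≤ K * ‖w.snd‖} :=
    isClosed_le (WithLp.prod_continuous_ofLp 2 _ _).fst.norm
      ((WithLp.prod_continuous_ofLp 2 _ _).snd.norm.const_mul K)
  have h : ‖v.val‖ ≤ K * v.semi := closure_minimal (fun w hw => hK w hw) hcl hmem
  refine (abs_le_of_sq_le_sq' ?_ (mul_nonneg (by positivity) v.semi_nonneg)).2
  rw [H10.norm_sq]
  nlinarith [pow_le_pow_left₀ (norm_nonneg _) h 2, sq_nonneg v.semi,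
    mul_nonneg hK0 (sq_nonneg v.semi)]

/-! ### Finite element spaces are closed -/

/-- A piecewise linear function is determined by its values at the vertices. -/
lemma IsPiecewiseLinear.eq_zero {T : Triangulation D} {q : Space d → ℝ}
    (hq : IsPiecewiseLinear T q) (h : ∀ s ∈ T.complex.faces, ∀ x ∈ s, q x = 0)
    {x : Space d} (hx : x ∈ D.cl) : q x = 0 := by
  rw [← T.space_eq, Geometry.SimplicialComplex.mem_space_iff] at hx
  obtain ⟨s, hs, hxs⟩ := hx
  obtain ⟨A, hA⟩ := hq.affine_on s hs
  have hconv : Convex ℝ (A ⁻¹' {0}) := (convex_singleton 0).affine_preimage A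
  have hsub : (s : Set (Space d)) ⊆ A ⁻¹' {0} := fun y hy => by
    have := hA (subset_convexHull ℝ _ hy)
    rw [h s hs y hy] at this
    exact this.symm
  rw [hA hxs]
  exact convexHull_min hsub hconv hxs

/-- The vertices of a triangulation. -/
def Triangulation.vertices (T : Triangulation D) : Set (Space d) :=
  ⋃ s ∈ T.complex.faces, (s : Set (Space d))

lemma Triangulation.finite_vertices (T : Triangulation D) : T.vertices.Finite :=
  T.finite.biUnion fun s _ => s.finite_toSet

lemma IsPiecewiseLinear.zero {T : Triangulation D} : IsPiecewiseLinear T 0 :=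
  ⟨continuousOn_const, fun _ _ => ⟨0, fun x _ => by simp⟩, fun _ _ => rfl⟩

lemma IsPiecewiseLinear.add {T : Triangulation D} {p q : Space d → ℝ} (hp : IsPiecewiseLinear T p)
    (hq : IsPiecewiseLinear T q) : IsPiecewiseLinear T (p + q) := by
  refine ⟨hp.continuousOn.add hq.continuousOn, fun s hs => ?_, fun x hx => ?_⟩
  · obtain ⟨A, hA⟩ := hp.affine_on s hs
    obtain ⟨B, hB⟩ := hq.affine_on s hs
    exact ⟨A + B, fun x hx => by simp [hA hx, hB hx]⟩
  · simp [hp.zero_on x hx, hq.zero_on x hx]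

lemma IsPiecewiseLinear.smul {T : Triangulation D} {p : Space d → ℝ} (c : ℝ)
    (hp : IsPiecewiseLinear T p) : IsPiecewiseLinear T (c • p) := by
  refine ⟨hp.continuousOn.const_smul c, fun s hs => ?_, fun x hx => ?_⟩
  · obtain ⟨A, hA⟩ := hp.affine_on s hs
    exact ⟨c • A, fun x hx => by simp [hA hx]⟩
  · simp [hp.zero_on x hx]

/-- The pairs of a class in `L²(D)` with a piecewise linear representative and the values of that
representative at the vertices. -/
def vertexGraph (T : Triangulation D) : Submodule ℝ (Lp ℝ 2 D.vol × (T.vertices → ℝ)) where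
  carrier := {w | ∃ q, IsPiecewiseLinear T q ∧ w.1 =ᵐ[D.vol] q ∧ ∀ x, w.2 x = q x}
  zero_mem' := ⟨0, IsPiecewiseLinear.zero, Lp.coeFn_zero ℝ 2 D.vol, fun _ => rfl⟩
  add_mem' := by
    rintro a b ⟨p, hp, hap, hp'⟩ ⟨q, hq, hbq, hq'⟩
    exact ⟨p + q, hp.add hq, (Lp.coeFn_add a.1 b.1).trans (hap.add hbq), fun x => by
      simp [hp', hq']⟩
  smul_mem' := by
    rintro c a ⟨p, hp, hap, hp'⟩
    exact ⟨c • p, hp.smul c, (Lp.coeFn_smul c a.1).trans (hap.const_smul c), fun x => by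
      simp [hp']⟩

/-- Projection to the finitely many vertex values is injective, because vanishing at the vertices
forces the function to vanish on `D̄`. -/
instance (T : Triangulation D) : FiniteDimensional ℝ (vertexGraph T) := by
  have := T.finite_vertices.to_subtype
  refine Module.Finite.of_injective
    ((LinearMap.snd ℝ (Lp ℝ 2 D.vol) (T.vertices → ℝ)).comp (vertexGraph T).subtype) ?_
  rw [← LinearMap.ker_eq_bot, LinearMap.ker_eq_bot']
  rintro ⟨w, q, hq, hwq, hv⟩ hw
  have hw2 : w.2 = 0 := hw
  have hz : ∀ x ∈ D.cl, q x = 0 := fun x hx => by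
    refine hq.eq_zero (fun s hs y hy => ?_) hx
    have := hv ⟨y, Set.mem_biUnion hs hy⟩
    rw [← this, hw2]; rfl
  have hw1 : w.1 = 0 := by
    refine Lp.ext ((hwq.trans ?_).trans (Lp.coeFn_zero ℝ 2 D.vol).symm)
    filter_upwards [ae_restrict_mem D.isOpen.measurableSet] with x hx
    exact hz x (subset_closure hx)
  exact Subtype.ext (Prod.ext hw1 hw2)

/-- Membership only concerns the function component, so the space is the preimage of a
finite-dimensional, hence closed, subspace of `L²(D)` under a continuous map. Closedness is what
Lax–Milgram on the subspace needs. -/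
lemma isClosed_feSpace (T : Triangulation D) : IsClosed (feSpace T : Set (H10 D)) := by
  have h : (feSpace T : Set (H10 D)) = H10.val ⁻¹'
      ((vertexGraph T).map (LinearMap.fst ℝ (Lp ℝ 2 D.vol) (T.vertices → ℝ)) :
        Set (Lp ℝ 2 D.vol)) := by
    ext v
    constructor
    · rintro ⟨q, hq, hv⟩
      exact ⟨(v.val, fun x => q x), ⟨q, hq, hv, fun _ => rfl⟩, rfl⟩
    · rintro ⟨w, ⟨q, hq, hv, -⟩, hw⟩
      refine ⟨q, hq, ?_⟩
      rw [← hw]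
      exact hv
  rw [h]
  refine (Submodule.closed_of_finiteDimensional _).preimage ?_
  exact (WithLp.prod_continuous_ofLp 2 _ _).fst.comp continuous_subtype_val

/-! ### Finite element solutions -/

/-- **Lax–Milgram** for a symmetric form on a closed subspace. -/
lemma exists_forall_mem_eq_of_coercive {V : Type*} [NormedAddCommGroup V] [InnerProductSpace ℝ V]
    [CompleteSpace V] {W : Submodule ℝ V} (hW : IsClosed (W : Set V)) {b : V → V → ℝ}
    (hcomm : ∀ v w, b v w = b w v) (hadd : ∀ u v w, b (u + v) w = b u w + b v w)
    (hsmul : ∀ (c : ℝ) v w, b (c • v) w = c * b v w) {M : ℝ}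
    (hM : ∀ v w, |b v w| ≤ M * ‖v‖ * ‖w‖) {c : ℝ} (hc : 0 < c)
    (hcoer : ∀ v, c * ‖v‖ * ‖v‖ ≤ b v v) (f : V →L[ℝ] ℝ) :
    ∃ p ∈ W, ∀ q ∈ W, b p q = f q := by
  have : CompleteSpace W := hW.completeSpace_coe
  let B : W →L[ℝ] W →L[ℝ] ℝ := LinearMap.mkContinuous₂
    (LinearMap.mk₂ ℝ (fun v w : W => b v w)
      (fun u v w => hadd u v w) (fun c v w => hsmul c v w)
      (fun u v w => by rw [hcomm, hcomm u v, hcomm u w]; exact hadd v w u)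
      (fun c v w => by rw [hcomm, hcomm v w]; exact hsmul c w v))
    M fun v w => hM v w
  have hco : IsCoercive B := ⟨c, hc, fun v => hcoer v⟩
  set g : W := (InnerProductSpace.toDual ℝ W).symm (f.comp W.subtypeL)
  refine ⟨(hco.continuousLinearEquivOfBilin.symm g : W), Subtype.mem _, fun q hq => ?_⟩
  have h := hco.continuousLinearEquivOfBilin_apply
    (hco.continuousLinearEquivOfBilin.symm g) ⟨q, hq⟩
  rw [ContinuousLinearEquiv.apply_symm_apply, InnerProductSpace.toDual_symm_apply] at h
  exact h.symm

instance (D : BoundedDomain d) : CompleteSpace (H10 D) :=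
  (Submodule.isClosed_topologicalClosure _).completeSpace_coe

lemma exists_isFESolution (hd : 1 ≤ d) (T : Triangulation D) (f : H10 D →L[ℝ] ℝ) {k : CField D}
    {c : ℝ} (hc : 0 < c) (hk : ∀ x, c ≤ k x) : ∃ p, IsFESolution T f k p := by
  obtain ⟨K, hK0, hK⟩ := poincare hd D
  refine exists_forall_mem_eq_of_coercive (isClosed_feSpace T) (bilin_comm k) (bilin_add_left k)
    (bilin_smul_left k) (M := ‖k‖) (fun v w => ?_) (c := c / K ^ 2) (by positivity)
    (fun v => ?_) f
  · refine (abs_bilin_le k v w).trans ?_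
    exact mul_le_mul (mul_le_mul_of_nonneg_left v.semi_le_norm (norm_nonneg _)) w.semi_le_norm
      w.semi_nonneg (by positivity)
  · refine le_trans ?_ (le_bilin_self hk v)
    have h1 : ‖v‖ ≤ K * v.semi := hK v
    rw [div_mul_eq_mul_div, div_mul_eq_mul_div, div_le_iff₀ (by positivity), mul_assoc, mul_assoc]
    refine mul_le_mul_of_nonneg_left ?_ hc.le
    nlinarith [mul_le_mul h1 h1 (norm_nonneg _) (mul_nonneg hK0.le v.semi_nonneg)]

lemma isFESolution_feSolution (hd : 1 ≤ d) (T : Triangulation D) (f : H10 D →L[ℝ] ℝ)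
    {k : CField D} {c : ℝ} (hc : 0 < c) (hk : ∀ x, c ≤ k x) :
    IsFESolution T f k (feSolution T f k) := by
  have h := exists_isFESolution hd T f hc hk
  rw [feSolution, dif_pos h]
  exact h.choose_spec

/-- The stability estimate for finite element solutions, uniform over all triangulations. -/
lemma exists_semi_feSolution_le (hd : 1 ≤ d) (f : H10 D →L[ℝ] ℝ) :
    ∃ A : ℝ, 0 ≤ A ∧ ∀ (T : Triangulation D) (k : CField D) (c : ℝ), 0 < c → (∀ x, c ≤ k x) →
      (feSolution T f k).semi ≤ A / c := by
  obtain ⟨K, hK0, hK⟩ := poincare hd D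
  refine ⟨‖f‖ * K, by positivity, fun T k c hc hk => ?_⟩
  obtain ⟨hp, hsol⟩ := isFESolution_feSolution hd T f hc hk
  set p := feSolution T f k
  have h1 : c * p.semi ^ 2 ≤ ‖f‖ * (K * p.semi) := calc
    c * p.semi ^ 2 ≤ bilin k p p := le_bilin_self hk p
    _ = f p := hsol p hp
    _ ≤ ‖f‖ * ‖p‖ := (le_abs_self _).trans (f.le_opNorm p)
    _ ≤ ‖f‖ * (K * p.semi) := by gcongr; exact hK p
  rw [le_div_iff₀ hc]
  -- One factor of the seminorm is cancelled, so the case where it vanishes is separate.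
  rcases p.semi_nonneg.eq_or_lt' with h0 | h0
  · rw [h0]; simp; positivity
  · nlinarith

/-- Finite element solutions depend continuously on the coefficient. -/
lemma continuousAt_feSolution (hd : 1 ≤ d) (T : Triangulation D) (f : H10 D →L[ℝ] ℝ)
    {k : CField D} {c : ℝ} (hc : 0 < c) (hk : ∀ x, c ≤ k x) :
    ContinuousAt (feSolution T f) k := by
  obtain ⟨K, hK0, hK⟩ := poincare hd D
  obtain ⟨hp, hsol⟩ := isFESolution_feSolution hd T f hc hk
  set p := feSolution T f k
  have hev : ∀ᶠ l in 𝓝 k, dist (feSolution T f l) p ≤ K * (‖l - k‖ * p.semi / (c / 2)) := by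
    filter_upwards [Metric.ball_mem_nhds k (half_pos hc)] with l hl
    -- Within distance `c / 2` of `k` the coefficient keeps the lower bound `c / 2`.
    have hlk : ∀ x, c / 2 ≤ l x := fun x => by
      have h1 : |(l - k) x| ≤ ‖l - k‖ := (l - k).norm_coe_le_norm x
      rw [Metric.mem_ball, dist_eq_norm] at hl
      rw [ContinuousMap.sub_apply] at h1
      have := (abs_le.1 h1).1
      linarith [hk x]
    obtain ⟨hp', hsol'⟩ := isFESolution_feSolution hd T f (half_pos hc) hlk
    set p' := feSolution T f l
    have hmem : p' - p ∈ feSpace T := sub_mem hp' hp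
    -- Both solutions are tested with their difference `p' - p` in the same discrete space; the
    -- right-hand side cancels and only the change of coefficient acting on `p` remains.
    have h1 : c / 2 * (p' - p).semi ^ 2 ≤ ‖l - k‖ * p.semi * (p' - p).semi := calc
      c / 2 * (p' - p).semi ^ 2 ≤ bilin l (p' - p) (p' - p) := le_bilin_self hlk _
      _ = -bilin (l - k) p (p' - p) := by
        rw [bilin_sub_left, hsol' _ hmem, ← hsol _ hmem, bilin_coeff_sub]; ring
      _ ≤ ‖l - k‖ * p.semi * (p' - p).semi := (neg_le_abs _).trans (abs_bilin_le _ _ _)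
    rw [dist_eq_norm]
    refine (hK _).trans (mul_le_mul_of_nonneg_left ?_ hK0.le)
    rw [le_div_iff₀ (half_pos hc)]
    have h2 := p.semi_nonneg
    rcases (p' - p).semi_nonneg.eq_or_lt' with h0 | h0
    · rw [h0]; simp; positivity
    · nlinarith
  refine tendsto_iff_dist_tendsto_zero.2
    (squeeze_zero' (.of_forall fun _ => dist_nonneg) hev ?_)
  have : Continuous fun l : CField D => K * (‖l - k‖ * p.semi / (c / 2)) := by fun_prop
  simpa using this.tendsto k

/-! ### Self-normalised Monte Carlo averages -/

/-- Jensen's inequality for `x ↦ x ^ r` and the normalised weights. -/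
lemma abs_ratio_rpow_le {ι : Type*} [Fintype ι] [Nonempty ι] {t : ι → ℝ} (a : ι → ℝ)
    (ht : ∀ i, 0 < t i) {r : ℝ} (hr : 1 ≤ r) :
    |(∑ i, t i * a i) / ∑ i, t i| ^ r ≤ ∑ i, t i / (∑ j, t j) * |a i| ^ r := by
  have hpos : 0 < ∑ j, t j := Finset.sum_pos (fun i _ => ht i) Finset.univ_nonempty
  have h1 : |(∑ i, t i * a i) / ∑ i, t i| ≤ ∑ i, t i / (∑ j, t j) * |a i| := by
    rw [Finset.sum_div]
    refine (Finset.abs_sum_le_sum_abs _ _).trans_eq (Finset.sum_congr rfl fun i _ => ?_)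
    rw [abs_div, abs_mul, abs_of_pos (ht i), abs_of_pos hpos]
    ring
  refine (Real.rpow_le_rpow (abs_nonneg _) h1 (by linarith)).trans ?_
  refine Real.rpow_arith_mean_le_arith_mean_rpow _ _ _ (fun i _ => by
    have := ht i; positivity) ?_ (fun i _ => abs_nonneg _) hr
  rw [← Finset.sum_div, div_self hpos.ne']

/-- The number, as a real number, of indices `j ≠ i` with `δ ≤ t j`. -/
def othersAbove {ι : Type*} [Fintype ι] [DecidableEq ι] (δ : ℝ) (t : ι → ℝ) (i : ι) : ℝ :=
  ∑ j ∈ Finset.univ.erase i, (Set.Ici δ).indicator 1 (t j)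

lemma othersAbove_nonneg {ι : Type*} [Fintype ι] [DecidableEq ι] (δ : ℝ) (t : ι → ℝ) (i : ι) :
    0 ≤ othersAbove δ t i :=
  Finset.sum_nonneg fun _ _ => Set.indicator_nonneg (fun _ _ => zero_le_one) _

/-- This decouples the `i`-th weight from `t i`. With `b` the number of other indices above `δ`, the
weight is at most `t i / (t i + δ b)`, which increases in `t i ≤ 1`, and `1 / (1 + δ b) ≤ δ⁻¹ / (1 +
b)` because `δ ≤ 1`. -/
lemma weight_le {ι : Type*} [Fintype ι] [DecidableEq ι] {t : ι → ℝ} (ht : ∀ i, 0 < t i)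
    (ht1 : ∀ i, t i ≤ 1) {δ : ℝ} (hδ : 0 < δ) (hδ1 : δ ≤ 1) (i : ι) :
    t i / (∑ j, t j) ≤ δ⁻¹ * (1 + othersAbove δ t i)⁻¹ := by
  have hb := othersAbove_nonneg δ t i
  have hsum : t i + δ * othersAbove δ t i ≤ ∑ j, t j := by
    rw [← Finset.add_sum_erase _ _ (Finset.mem_univ i), othersAbove, Finset.mul_sum]
    gcongr with j hj
    by_cases h : t j ∈ Set.Ici δ
    · have h' : δ ≤ t j := h
      rw [Set.indicator_of_mem h]
      simpa using h'
    · simpa [h] using (ht j).le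
  rw [← mul_inv, ← one_div, div_le_div_iff₀ (by nlinarith [ht i]) (by positivity)]
  nlinarith [mul_le_mul_of_nonneg_right (ht1 i) hb, mul_le_mul_of_nonneg_right hδ1 (ht i).le,
    mul_le_mul_of_nonneg_left (mul_le_mul_of_nonneg_right (ht1 i) hb) hδ.le]

/-- If `n` indices lie above `δ`, each of them contributes `1 / n` and the others contribute
nothing; for `n = 0` the sum is `0`. -/
lemma sum_indicator_mul_inv_le {ι : Type*} [Fintype ι] [DecidableEq ι] (δ : ℝ) (t : ι → ℝ) :
    ∑ i, (Set.Ici δ).indicator 1 (t i) * (1 + othersAbove δ t i)⁻¹ ≤ (1 : ℝ) := by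
  set n : ℝ := ∑ i, (Set.Ici δ).indicator 1 (t i) with hn
  have h : ∀ i, (Set.Ici δ).indicator 1 (t i) * (1 + othersAbove δ t i)⁻¹
      = (Set.Ici δ).indicator 1 (t i) / n := fun i => by
    by_cases hi : t i ∈ Set.Ici δ
    · have : n = 1 + othersAbove δ t i := by
        rw [hn, ← Finset.add_sum_erase _ _ (Finset.mem_univ i), othersAbove]
        simp [hi]
      rw [this, div_eq_mul_inv]
    · simp [hi]
  simp only [h]
  rw [← Finset.sum_div]
  exact div_self_le_one n

/-- A bound for self-normalised Monte Carlo averages which does not depend on the sample size: it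
suffices that the weights are bounded below with probability at least `1/2`. -/
lemma lintegral_ratio_rpow_le {E Ω : Type*} [MeasurableSpace E] {P : Measure E}
    {θ φ : E → ℝ} (hθm : AEMeasurable θ P) (hφm : AEMeasurable φ P)
    (hθ : ∀ x, 0 < θ x) (hθ1 : ∀ x, θ x ≤ 1) {δ : ℝ} (hδ : 0 < δ) (hδ1 : δ ≤ 1)
    (hP : 2⁻¹ ≤ P {x | δ ≤ θ x}) {r : ℝ} (hr : 1 ≤ r)
    [MeasurableSpace Ω] {μ : Measure Ω} [IsProbabilityMeasure μ] {N : ℕ} (hN : 1 ≤ N)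
    {X : Fin N → Ω → E} (hX : ∀ i, HasLaw (X i) P μ) (hind : iIndepFun X μ) :
    ∫⁻ ω, ENNReal.ofReal
        (|(∑ i, θ (X i ω) * φ (X i ω)) / ∑ i, θ (X i ω)| ^ r) ∂μ
      ≤ ENNReal.ofReal δ⁻¹ * 2 * ∫⁻ x, ENNReal.ofReal (|φ x| ^ r) ∂P := by
  have : Nonempty (Fin N) := ⟨⟨0, hN⟩⟩
  have hθX : ∀ i, AEMeasurable θ (μ.map (X i)) := fun i => by rw [(hX i).map_eq]; exact hθm
  have hφX : ∀ i, AEMeasurable φ (μ.map (X i)) := fun i => by rw [(hX i).map_eq]; exact hφm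
  set Y : Fin N → Ω → ℝ × ℝ := fun i ω => (θ (X i ω), φ (X i ω)) with hY
  have hYm : ∀ i, AEMeasurable (Y i) μ := fun i =>
    ((hθX i).comp_aemeasurable (hX i).aemeasurable).prodMk
      ((hφX i).comp_aemeasurable (hX i).aemeasurable)
  have hYind : iIndepFun Y μ :=
    hind.comp₀ (fun _ x => (θ x, φ x)) (fun i => (hX i).aemeasurable)
      (fun i => (hθX i).prodMk (hφX i))
  set c : Fin N → Ω → ℝ≥0∞ := fun i ω =>
    ENNReal.ofReal (1 + othersAbove δ (fun j => θ (X j ω)) i)⁻¹ with hc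
  have hindic : Measurable ((Set.Ici δ).indicator (1 : ℝ → ℝ)) :=
    measurable_one.indicator measurableSet_Ici
  have hnn : ∀ x, 0 ≤ (Set.Ici δ).indicator (1 : ℝ → ℝ) x := fun x =>
    Set.indicator_nonneg (fun _ _ => zero_le_one) x
  have hprod : ∀ (i : Fin N) (g : ℝ × ℝ → ℝ≥0∞), Measurable g →
      ∫⁻ ω, g (Y i ω) * c i ω ∂μ = (∫⁻ ω, g (Y i ω) ∂μ) * ∫⁻ ω, c i ω ∂μ := by
    intro i g hg
    -- `c i` is a function of the samples other than the `i`-th, so it is independent of `Y i`.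
    have h1 := hYind.indepFun_finset₀ {i} (Finset.univ.erase i) (by simp) hYm
    have hl : Measurable fun a : ({j // j ∈ ({i} : Finset (Fin N))} → ℝ × ℝ) =>
        g (a ⟨i, Finset.mem_singleton_self i⟩) := hg.comp (measurable_pi_apply _)
    have hrm : Measurable fun a : ({j // j ∈ Finset.univ.erase i} → ℝ × ℝ) =>
        ENNReal.ofReal (1 + ∑ j, (Set.Ici δ).indicator (1 : ℝ → ℝ) (a j).1)⁻¹ := by
      refine (measurable_const.add (Finset.measurable_sum _ fun j _ => ?_)).inv.ennreal_ofReal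
      exact hindic.comp (measurable_fst.comp (measurable_pi_apply j))
    have h2 := h1.comp hl hrm
    have hce : c i = fun ω => ENNReal.ofReal (1 + ∑ j : {j // j ∈ Finset.univ.erase i},
        (Set.Ici δ).indicator (1 : ℝ → ℝ) (Y j ω).1)⁻¹ := by
      funext ω
      simp only [hc, othersAbove, hY]
      rw [Finset.sum_coe_sort (Finset.univ.erase i)
        (fun j => (Set.Ici δ).indicator (1 : ℝ → ℝ) (θ (X j ω)))]
    rw [hce]
    refine lintegral_mul_eq_lintegral_mul_lintegral_of_indepFun'' (hg.comp_aemeasurable (hYm i))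
      ?_ h2
    exact hrm.comp_aemeasurable (aemeasurable_pi_iff.2 fun j => hYm j)
  have hmap : ∀ (i : Fin N) (g : ℝ × ℝ → ℝ≥0∞), Measurable g →
      ∫⁻ ω, g (Y i ω) ∂μ = ∫⁻ x, g (θ x, φ x) ∂P := by
    intro i g hg
    have hgm : AEMeasurable (fun x => g (θ x, φ x)) (μ.map (X i)) :=
      hg.comp_aemeasurable ((hθX i).prodMk (hφX i))
    rw [← (hX i).map_eq, lintegral_map' hgm (hX i).aemeasurable]
  have hcm : ∀ i, AEMeasurable (c i) μ := fun i => by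
    refine (aemeasurable_const.add (Finset.aemeasurable_fun_sum _ fun j _ => ?_)).inv.ennreal_ofReal
    exact hindic.comp_aemeasurable (hYm j).fst
  -- Inserting the indicator `χ` of `θ ≥ δ` costs a factor of at most `2` in expectation, by
  -- independence, and makes the sum pointwise at most `1`.
  have hsum : ∑ i, ∫⁻ ω, c i ω ∂μ ≤ 2 := by
    set χ : ℝ × ℝ → ℝ≥0∞ := fun y => ENNReal.ofReal ((Set.Ici δ).indicator 1 y.1) with hχ
    have hχm : Measurable χ := (hindic.comp measurable_fst).ennreal_ofReal
    have h1 : ∀ i, 2⁻¹ ≤ ∫⁻ ω, χ (Y i ω) ∂μ := fun i => by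
      refine hP.trans ?_
      rw [hmap i χ hχm]
      have hms : NullMeasurableSet {x | δ ≤ θ x} P :=
        nullMeasurableSet_le aemeasurable_const hθm
      rw [← lintegral_indicator_one₀ hms]
      refine lintegral_mono fun x => ?_
      by_cases hx : δ ≤ θ x <;> simp [hχ, hx]
    have h2 : ∑ i, ∫⁻ ω, χ (Y i ω) * c i ω ∂μ ≤ 1 := by
      have hm : ∀ i, AEMeasurable (fun ω => χ (Y i ω) * c i ω) μ := fun i =>
        (hχm.comp_aemeasurable (hYm i)).mul (hcm i)
      rw [← lintegral_finsetSum' _ fun i _ => hm i]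
      refine (lintegral_mono (g := fun _ => 1) fun ω => ?_).trans (by simp)
      have h3 := sum_indicator_mul_inv_le δ (fun j => θ (X j ω))
      rw [← ENNReal.ofReal_le_ofReal_iff zero_le_one, ENNReal.ofReal_one,
        ENNReal.ofReal_sum_of_nonneg fun i _ => mul_nonneg (hnn _)
          (inv_nonneg.2 (add_nonneg zero_le_one (othersAbove_nonneg _ _ _)))] at h3
      refine le_trans (le_of_eq (Finset.sum_congr rfl fun i _ => ?_)) h3
      rw [ENNReal.ofReal_mul (hnn _)]
    have h3 : ∑ i, 2⁻¹ * ∫⁻ ω, c i ω ∂μ ≤ 1 := by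
      refine le_trans (Finset.sum_le_sum fun i _ => ?_) h2
      rw [hprod i χ hχm]
      exact mul_le_mul' (h1 i) le_rfl
    rw [← Finset.mul_sum] at h3
    calc ∑ i, ∫⁻ ω, c i ω ∂μ = 2 * (2⁻¹ * ∑ i, ∫⁻ ω, c i ω ∂μ) := by
          rw [← mul_assoc, ENNReal.mul_inv_cancel (by simp) (by simp), one_mul]
      _ ≤ 2 * 1 := by gcongr
      _ = 2 := mul_one 2
  set ρ : ℝ × ℝ → ℝ≥0∞ := fun y => ENNReal.ofReal (|y.2| ^ r) with hρ
  have hρm : Measurable ρ := by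
    refine Measurable.ennreal_ofReal ?_
    exact (measurable_snd.abs).pow_const r
  have hρi : ∀ i, ∫⁻ ω, ρ (Y i ω) ∂μ = ∫⁻ x, ENNReal.ofReal (|φ x| ^ r) ∂P := fun i =>
    hmap i ρ hρm
  calc ∫⁻ ω, ENNReal.ofReal (|(∑ i, θ (X i ω) * φ (X i ω)) / ∑ i, θ (X i ω)| ^ r) ∂μ
      ≤ ∫⁻ ω, ∑ i, ENNReal.ofReal δ⁻¹ * (ρ (Y i ω) * c i ω) ∂μ := by
        refine lintegral_mono fun ω => ?_
        refine (ENNReal.ofReal_le_ofReal (abs_ratio_rpow_le (fun i => φ (X i ω))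
          (fun i => hθ (X i ω)) hr)).trans ?_
        rw [ENNReal.ofReal_sum_of_nonneg fun i _ => mul_nonneg
          (div_nonneg (hθ _).le (Finset.sum_nonneg fun j _ => (hθ _).le)) (by positivity)]
        refine Finset.sum_le_sum fun i _ => ?_
        have hw := weight_le (fun j => hθ (X j ω)) (fun j => hθ1 (X j ω)) hδ hδ1 i
        have := mul_le_mul_of_nonneg_right hw (b := _) (a := |φ (X i ω)| ^ r) (by positivity)
        refine (ENNReal.ofReal_le_ofReal this).trans_eq ?_
        have := othersAbove_nonneg δ (fun j => θ (X j ω)) i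
        rw [ENNReal.ofReal_mul (by positivity), ENNReal.ofReal_mul (by positivity)]
        simp only [hρ, hc, hY]
        ring
    _ = ENNReal.ofReal δ⁻¹ * ∑ i, (∫⁻ ω, ρ (Y i ω) ∂μ) * ∫⁻ ω, c i ω ∂μ := by
        have hm : ∀ i, AEMeasurable (fun ω => ENNReal.ofReal δ⁻¹ * (ρ (Y i ω) * c i ω)) μ :=
          fun i => ((hρm.comp_aemeasurable (hYm i)).mul (hcm i)).const_mul _
        rw [lintegral_finsetSum' _ fun i _ => hm i, Finset.mul_sum]
        refine Finset.sum_congr rfl fun i _ => ?_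
        rw [lintegral_const_mul' _ _ ENNReal.ofReal_ne_top, hprod i ρ hρm]
    _ ≤ ENNReal.ofReal δ⁻¹ * 2 * ∫⁻ x, ENNReal.ofReal (|φ x| ^ r) ∂P := by
        simp only [hρi]
        rw [← Finset.mul_sum, mul_assoc]
        rw [mul_comm (∫⁻ x, _ ∂P)]
        gcongr

/-! ### Gaussian series in Banach spaces -/

section GaussianSeries

variable {E : Type*} [NormedAddCommGroup E] [NormedSpace ℝ E]

/-- The law of a sequence of independent standard Gaussian variables. -/
abbrev gaussianSeq : Measure (ℕ → ℝ) := Measure.infinitePi fun _ : ℕ => gaussianReal 0 1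

lemma hasGaussianLaw_eval (j : ℕ) : HasGaussianLaw (fun ξ : ℕ → ℝ => ξ j) gaussianSeq :=
  HasLaw.hasGaussianLaw (μ := gaussianReal 0 1)
    ⟨(measurable_pi_apply j).aemeasurable, Measure.infinitePi_map_eval (fun _ : ℕ => gaussianReal 0 1) j⟩

lemma integral_eval_gaussianSeq (j : ℕ) : ∫ ξ, ξ j ∂gaussianSeq = 0 := by
  have h := integral_map (μ := gaussianSeq) (φ := fun ξ : ℕ → ℝ => ξ j)
    (measurable_pi_apply j).aemeasurable
    (f := fun x : ℝ => x) (by fun_prop)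
  rw [Measure.infinitePi_map_eval (fun _ : ℕ => gaussianReal 0 1) j] at h
  rw [← h]
  simp

/-- The partial sums of the Gaussian series `∑ⱼ ξⱼ aⱼ`. -/
def seriesSum (a : ℕ → E) (n : ℕ) (ξ : ℕ → ℝ) : E := ∑ j ∈ Finset.range n, ξ j • a j

lemma continuous_seriesSum (a : ℕ → E) (n : ℕ) : Continuous (seriesSum a n) := by
  unfold seriesSum; fun_prop

variable [CompleteSpace E] [SecondCountableTopology E] [MeasurableSpace E] [BorelSpace E]

lemma hasGaussianLaw_seriesSum (a : ℕ → E) (n : ℕ) :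
    HasGaussianLaw (seriesSum a n) gaussianSeq := by
  have hind : iIndepFun (fun (j : ℕ) (ξ : ℕ → ℝ) => ξ j • a j) gaussianSeq :=
    iIndepFun_infinitePi (X := fun j x => x • a j) (by fun_prop)
  have h : HasGaussianLaw (fun ξ : ℕ → ℝ => ∑ i : Fin n, ξ i • a i) gaussianSeq := by
    refine iIndepFun.hasGaussianLaw_fun_sum (X := fun (i : Fin n) (ξ : ℕ → ℝ) => ξ i • a i)
      (fun i => ?_)
      (hind.precomp Fin.val_injective)
    exact (hasGaussianLaw_eval i).map_fun (ContinuousLinearMap.toSpanSingleton ℝ (a i))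
  convert h using 1
  funext ξ
  exact (Fin.sum_univ_eq_sum_range (fun j => ξ j • a j) n).symm

/-- Two independent copies of a centred Gaussian are jointly invariant under rotation; centredness
is checked on each continuous functional. -/
lemma map_rotation_seriesSum (a : ℕ → E) (n : ℕ) (t : ℝ) :
    ((gaussianSeq.map (seriesSum a n)).prod (gaussianSeq.map (seriesSum a n))).map
        (ContinuousLinearMap.rotation t)
      = (gaussianSeq.map (seriesSum a n)).prod (gaussianSeq.map (seriesSum a n)) := by
  have := (hasGaussianLaw_seriesSum a n).isGaussian_map
  refine IsGaussian.map_rotation_eq_self_of_forall_strongDual_eq_zero (fun L => ?_) t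
  rw [integral_map (continuous_seriesSum a n).aemeasurable (by fun_prop)]
  simp only [seriesSum, map_sum, map_smul, smul_eq_mul]
  rw [integral_finsetSum _ fun j _ => ((hasGaussianLaw_eval j).integrable).mul_const _]
  simp only [integral_mul_const, integral_eval_gaussianSeq, zero_mul, Finset.sum_const_zero]

/-- Rotation invariance is all that Fernique's argument uses, and it passes to almost sure limits:
integrals of bounded continuous functions converge by dominated convergence, and they determine a
finite measure. The limit need not be shown to be Gaussian. -/
lemma map_rotation_of_tendsto {a : ℕ → E} {W : (ℕ → ℝ) → E} (hWm : Measurable W)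
    (hW : ∀ᵐ ξ ∂gaussianSeq, Tendsto (fun n => seriesSum a n ξ) atTop (𝓝 (W ξ))) (t : ℝ) :
    ((gaussianSeq.map W).prod (gaussianSeq.map W)).map (ContinuousLinearMap.rotation t)
      = (gaussianSeq.map W).prod (gaussianSeq.map W) := by
  have : IsProbabilityMeasure (gaussianSeq.map W) :=
    Measure.isProbabilityMeasure_map hWm.aemeasurable
  have hrot : Continuous (ContinuousLinearMap.rotation t : E × E →L[ℝ] E × E) :=
    ContinuousLinearMap.continuous _
  have : IsProbabilityMeasure (((gaussianSeq.map W).prod (gaussianSeq.map W)).map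
      (ContinuousLinearMap.rotation t)) :=
    Measure.isProbabilityMeasure_map hrot.measurable.aemeasurable
  have hsm : ∀ n, Measurable (seriesSum a n) := fun n => (continuous_seriesSum a n).measurable
  have hlim : ∀ G : E × E → ℝ, Continuous G → ∀ B, (∀ x, ‖G x‖ ≤ B) →
      Tendsto (fun n => ∫ x, G x ∂(gaussianSeq.map (seriesSum a n)).prod
        (gaussianSeq.map (seriesSum a n))) atTop
        (𝓝 (∫ x, G x ∂(gaussianSeq.map W).prod (gaussianSeq.map W))) := by
    intro G hG B hB
    have hmap : ∀ V : (ℕ → ℝ) → E, Measurable V →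
        ∫ x, G x ∂(gaussianSeq.map V).prod (gaussianSeq.map V)
          = ∫ ζ, G (V ζ.1, V ζ.2) ∂gaussianSeq.prod gaussianSeq := by
      intro V hV
      rw [Measure.map_prod_map _ _ hV hV,
        integral_map (hV.prodMap hV).aemeasurable hG.aestronglyMeasurable]
      rfl
    simp only [hmap _ (hsm _), hmap W hWm]
    refine tendsto_integral_of_dominated_convergence (fun _ => B) (fun n => ?_)
      (integrable_const _) (fun n => .of_forall fun ζ => hB _) ?_
    · exact (hG.comp (((continuous_seriesSum a n).comp continuous_fst).prodMk
        ((continuous_seriesSum a n).comp continuous_snd))).aestronglyMeasurable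
    · filter_upwards [Measure.quasiMeasurePreserving_fst.ae hW,
        Measure.quasiMeasurePreserving_snd.ae hW] with ζ h1 h2
      exact (hG.tendsto _).comp (h1.prodMk_nhds h2)
  refine ext_of_forall_integral_eq_of_IsFiniteMeasure fun F => ?_
  rw [integral_map hrot.measurable.aemeasurable F.continuous.aestronglyMeasurable]
  refine tendsto_nhds_unique (hlim (fun x => F (ContinuousLinearMap.rotation t x))
    (F.continuous.comp hrot) ‖F‖ fun x => F.norm_coe_le_norm _) ?_
  refine (hlim F F.continuous ‖F‖ F.norm_coe_le_norm).congr fun n => ?_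
  conv_lhs => rw [← map_rotation_seriesSum a n t]
  rw [integral_map hrot.measurable.aemeasurable F.continuous.aestronglyMeasurable]

end GaussianSeries

/-! ### Exponential moments of Gaussian series. -/

section Fernique

variable {E : Type*} [NormedAddCommGroup E] [NormedSpace ℝ E] [CompleteSpace E]
  [SecondCountableTopology E]

/-- **Fernique's theorem** for Gaussian series. -/
lemma exists_integrable_exp_sq_series {a : ℕ → E} {W : (ℕ → ℝ) → E}
    (hW : ∀ᵐ ξ ∂gaussianSeq, Tendsto (fun n => seriesSum a n ξ) atTop (𝓝 (W ξ))) :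
    ∃ C, 0 < C ∧ Integrable (fun ξ => Real.exp (C * ‖W ξ‖ ^ 2)) gaussianSeq := by
  borelize E
  have hWm : AEMeasurable W gaussianSeq :=
    aemeasurable_of_tendsto_metrizable_ae atTop
      (fun n => (continuous_seriesSum a n).aemeasurable) hW
  have hae := hWm.ae_eq_mk
  have hmk : ∀ᵐ ξ ∂gaussianSeq, Tendsto (fun n => seriesSum a n ξ) atTop (𝓝 (hWm.mk W ξ)) := by
    filter_upwards [hW, hae] with ξ h1 h2
    rwa [← h2]
  obtain ⟨C, hC, hint⟩ := exists_integrable_exp_sq_of_map_rotation_eq_self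
    (map_rotation_of_tendsto hWm.measurable_mk hmk _)
  refine ⟨C, hC, ?_⟩
  have h := (integrable_map_measure (by fun_prop) hWm.measurable_mk.aemeasurable).1 hint
  refine h.congr ?_
  filter_upwards [hae] with ξ h
  simp [h]

lemma integrable_exp_norm_series {a : ℕ → E} {W : (ℕ → ℝ) → E}
    (hW : ∀ᵐ ξ ∂gaussianSeq, Tendsto (fun n => seriesSum a n ξ) atTop (𝓝 (W ξ))) (q : ℝ) :
    Integrable (fun ξ => Real.exp (q * ‖W ξ‖)) gaussianSeq := by
  obtain ⟨C, hC, hint⟩ := exists_integrable_exp_sq_series hW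
  have hWm : AEStronglyMeasurable W gaussianSeq :=
    aestronglyMeasurable_of_tendsto_ae atTop
      (fun n => (continuous_seriesSum a n).aestronglyMeasurable) hW
  -- The constant comes from completing the square: `q x ≤ q² / (4C) + C x²`.
  refine (hint.const_mul (Real.exp (q ^ 2 / (4 * C)))).mono' ?_ (.of_forall fun ξ => ?_)
  · exact (Real.continuous_exp.comp (continuous_const.mul continuous_norm)).comp_aestronglyMeasurable
      hWm
  · rw [Real.norm_eq_abs, Real.abs_exp, ← Real.exp_add, Real.exp_le_exp]
    have : q ^ 2 / (4 * C) + C * ‖W ξ‖ ^ 2 - q * ‖W ξ‖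
        = (q - 2 * C * ‖W ξ‖) ^ 2 / (4 * C) := by field_simp; ring
    have h2 : 0 ≤ (q - 2 * C * ‖W ξ‖) ^ 2 / (4 * C) := by positivity
    linarith

end Fernique

/-! ### The random coefficient -/

lemma Prior.continuous_partialSum (S : Prior D) (n : ℕ) :
    Continuous fun ξ => S.partialSum ξ n := by
  unfold Prior.partialSum; fun_prop

instance (S : Prior D) : IsProbabilityMeasure S.law := by
  unfold Prior.law; infer_instance

lemma Prior.tendsto_field {S : Prior D} {ξ : ℕ → ℝ}
    (h : ∃ u : CField D, Tendsto (S.partialSum ξ) atTop (𝓝 u)) :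
    Tendsto (S.partialSum ξ) atTop (𝓝 (S.field ξ)) :=
  tendsto_nhds_limUnder h

lemma Prior.aestronglyMeasurable_field {S : Prior D}
    (h : ∀ᵐ ξ ∂S.law, ∃ u : CField D, Tendsto (S.partialSum ξ) atTop (𝓝 u)) :
    AEStronglyMeasurable S.field S.law :=
  aestronglyMeasurable_of_tendsto_ae atTop
    (fun n => (S.continuous_partialSum n).aestronglyMeasurable)
    (h.mono fun _ hξ => Prior.tendsto_field hξ)

lemma ae_uniformLaw : ∀ᵐ x ∂uniformLaw, |x| ≤ 1 := by
  refine Measure.ae_smul_measure ?_ _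
  filter_upwards [ae_restrict_mem measurableSet_Icc] with x hx
  exact abs_le.2 hx

/-- For a uniform prior the series converges, and the field is bounded below. -/
lemma Prior.uniform_field {S : Prior D} (hk : S.kind = .uniform)
    (hb : ∀ j, ‖S.basis j‖ = 1) (hs : Summable fun j => |S.weight j|) {m : ℝ}
    (hm : ∀ x, m ≤ S.mean x) :
    ∀ᵐ ξ ∂S.law, (∃ u : CField D, Tendsto (S.partialSum ξ) atTop (𝓝 u)) ∧
      ∀ x, m - ∑' j, |S.weight j| ≤ S.field ξ x := by
  have hξ : ∀ᵐ ξ ∂S.law, ∀ j, |ξ j| ≤ 1 := by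
    refine ae_all_iff.2 fun j => ?_
    have h := (measurePreserving_eval_infinitePi (fun _ : ℕ => S.kind.coordLaw)
      j).quasiMeasurePreserving.ae (p := fun x : ℝ => |x| ≤ 1) (by rw [hk]; exact ae_uniformLaw)
    exact h
  filter_upwards [hξ] with ξ hξ
  have hle : ∀ j, ‖(S.weight j * ξ j) • S.basis j‖ ≤ |S.weight j| := fun j => by
    rw [norm_smul, hb, mul_one, Real.norm_eq_abs, abs_mul]
    exact mul_le_of_le_one_right (abs_nonneg _) (hξ j)
  have hsum : Summable fun j => (S.weight j * ξ j) • S.basis j := .of_norm_bounded hs hle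
  have ht : Tendsto (S.partialSum ξ) atTop
      (𝓝 (S.mean + ∑' j, (S.weight j * ξ j) • S.basis j)) :=
    hsum.hasSum.tendsto_sum_nat.const_add _
  refine ⟨⟨_, ht⟩, fun x => ?_⟩
  rw [tendsto_nhds_unique (Prior.tendsto_field ⟨_, ht⟩) ht]
  have h1 : ‖∑' j, (S.weight j * ξ j) • S.basis j‖ ≤ ∑' j, |S.weight j| :=
    tsum_of_norm_bounded hs.hasSum hle
  have h2 := (abs_le.1 ((ContinuousMap.norm_coe_le_norm _ x).trans h1)).1
  rw [ContinuousMap.add_apply]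
  linarith [hm x]

/-- The random coefficient is a continuous function of a strongly measurable field, with positive
values. It is bounded below by `exp (-τ)` with a random variable `τ ≥ 0` that has exponential
moments of all orders. -/
lemma Prior.exists_coeff_bounds {S : Prior D} (hS : S.Admissible) :
    AEStronglyMeasurable S.field S.law ∧
    (∃ G : CField D → CField D, Continuous G ∧ (∀ u, ∃ c, 0 < c ∧ ∀ x, c ≤ G u x) ∧
      ∀ᵐ ξ ∂S.law, S.coeff ξ = G (S.field ξ)) ∧
    ∃ τ : (ℕ → ℝ) → ℝ, (∀ ξ, 0 ≤ τ ξ) ∧ (∀ q : ℝ, Integrable (fun ξ => Real.exp (q * τ ξ)) S.law) ∧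
      ∀ᵐ ξ ∂S.law, ∀ x, Real.exp (-τ ξ) ≤ S.coeff ξ x := by
  rcases hk : S.kind with _ | kstar
  · simp only [Prior.Admissible, hk] at hS
    obtain ⟨hb, hs, m, hm, hlt⟩ := hS
    have h := Prior.uniform_field hk hb hs hm
    have hcoeff : ∀ ξ, S.coeff ξ = S.field ξ := fun ξ => by simp only [Prior.coeff, hk]
    set c := m - ∑' j, |S.weight j| with hc
    have hc0 : 0 < c := sub_pos.2 hlt
    -- Truncation from below at `c` is positive on every field and almost surely leaves `u`
    -- unchanged.
    let mx : C(ℝ, ℝ) := ⟨fun t => max t c, by fun_prop⟩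
    refine ⟨Prior.aestronglyMeasurable_field (h.mono fun _ h => h.1),
      ⟨fun u => mx.comp u, ContinuousMap.continuous_postcomp mx, fun u => ⟨c, hc0, fun x => ?_⟩, ?_⟩,
      fun _ => max 0 (-Real.log c), fun _ => le_max_left _ _, fun q => integrable_const _, ?_⟩
    · exact le_max_right _ _
    · filter_upwards [h] with ξ hξ
      rw [hcoeff]
      ext x
      exact (max_eq_left (hξ.2 x)).symm
    · filter_upwards [h] with ξ hξ x
      rw [hcoeff]
      refine le_trans ?_ (hξ.2 x)
      calc Real.exp (-max 0 (-Real.log c)) ≤ Real.exp (Real.log c) := by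
            rw [Real.exp_le_exp]; linarith [le_max_right 0 (-Real.log c)]
        _ = c := Real.exp_log hc0
  · simp only [Prior.Admissible, hk] at hS
    obtain ⟨hnn, hconv⟩ := hS
    have hlaw : S.law = gaussianSeq := by simp only [Prior.law, hk]; rfl
    have hcoeff : ∀ ξ x, S.coeff ξ x = kstar x + Real.exp (S.field ξ x) := fun ξ x => by
      simp only [Prior.coeff, hk]; rfl
    let ex : C(ℝ, ℝ) := ⟨Real.exp, Real.continuous_exp⟩
    have hlow : ∀ u : CField D, ∀ x, Real.exp (-‖u‖) ≤ kstar x + Real.exp (u x) := fun u x => by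
      have h1 := (abs_le.1 (u.norm_coe_le_norm x)).1
      have h2 : Real.exp (-‖u‖) ≤ Real.exp (u x) := Real.exp_le_exp.2 h1
      linarith [hnn x]
    refine ⟨Prior.aestronglyMeasurable_field hconv,
      ⟨fun u => kstar + ex.comp u, continuous_const.add (ContinuousMap.continuous_postcomp ex),
        fun u => ⟨Real.exp (-‖u‖), Real.exp_pos _, hlow u⟩, .of_forall fun ξ => ?_⟩,
      fun ξ => ‖S.field ξ‖, fun _ => norm_nonneg _, fun q => ?_, .of_forall fun ξ x => ?_⟩
    · ext x
      exact hcoeff ξ x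
    · have hW : ∀ᵐ ξ ∂gaussianSeq, Tendsto
          (fun n => seriesSum (fun j => S.weight j • S.basis j) n ξ) atTop
          (𝓝 (S.field ξ - S.mean)) := by
        rw [← hlaw]
        filter_upwards [hconv] with ξ hξ
        refine ((Prior.tendsto_field hξ).sub_const S.mean).congr fun n => ?_
        simp only [Prior.partialSum, seriesSum, add_sub_cancel_left, smul_smul, mul_comm]
      -- The Gaussian series is `u - m₀`; the mean costs a constant factor, and `|q|` covers
      -- exponents of either sign.
      have hint := (integrable_exp_norm_series hW |q|).const_mul (Real.exp (|q| * ‖S.mean‖))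
      rw [← hlaw] at hint
      refine hint.mono' ?_ (.of_forall fun ξ => ?_)
      · exact (Real.continuous_exp.comp
          (continuous_const.mul continuous_norm)).comp_aestronglyMeasurable
          (Prior.aestronglyMeasurable_field hconv)
      · rw [Real.norm_eq_abs, Real.abs_exp, ← Real.exp_add, Real.exp_le_exp, ← mul_add]
        have h1 : ‖S.field ξ‖ ≤ ‖S.mean‖ + ‖S.field ξ - S.mean‖ := by
          simpa using norm_add_le S.mean (S.field ξ - S.mean)
        exact (mul_le_mul_of_nonneg_right (le_abs_self q) (norm_nonneg _)).trans
          (mul_le_mul_of_nonneg_left h1 (abs_nonneg q))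
    · rw [hcoeff]
      exact hlow _ x

/-! ### Uniform bounds for the finite element samples -/

lemma aemeasurable_comp_of_borel {α V β : Type*} [MeasurableSpace α] {P : Measure α}
    [TopologicalSpace V] [TopologicalSpace.PseudoMetrizableSpace V] [MeasurableSpace β]
    {p : α → V} (hp : AEStronglyMeasurable p P) {F : V → β} (hF : Measurable[borel V] F) :
    AEMeasurable (fun x => F (p x)) P := by
  borelize V
  exact hF.comp_aemeasurable hp.aemeasurable

/-- The map `G` has positive values at every field, not just almost every one, so the solution with
coefficient `G u` is continuous in `u` everywhere and preserves strong measurability. -/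
lemma aestronglyMeasurable_feSolution (hd : 1 ≤ d) {S : Prior D} (hS : S.Admissible)
    (f : H10 D →L[ℝ] ℝ) (T : Triangulation D) :
    AEStronglyMeasurable (fun ξ => feSolution T f (S.coeff ξ)) S.law := by
  obtain ⟨hm, ⟨G, hG, hpos, hae⟩, -⟩ := Prior.exists_coeff_bounds hS
  have hcont : Continuous fun u => feSolution T f (G u) := by
    refine continuous_iff_continuousAt.2 fun u => ?_
    obtain ⟨c, hc, hle⟩ := hpos u
    exact (continuousAt_feSolution hd T f hc hle).comp hG.continuousAt
  refine (hcont.comp_aestronglyMeasurable hm).congr ?_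
  filter_upwards [hae] with ξ hξ
  rw [hξ]

/-- A functional of polynomial growth is bounded by `B exp (n τ)` at arguments whose seminorm is
bounded by `A exp τ`. -/
lemma PolyGrowth.exists_le {E : Type*} [Norm E] {F : H10 D → E} (hF : PolyGrowth F) {A : ℝ}
    (hA : 0 ≤ A) : ∃ (B : ℝ) (n : ℕ), 0 ≤ B ∧ ∀ (v : H10 D) (t : ℝ), 0 ≤ t →
      v.semi ≤ A * Real.exp t → ‖F v‖ ≤ B * Real.exp (n * t) := by
  obtain ⟨M, hM, n, h⟩ := hF
  refine ⟨M * (1 + A ^ n), n, by positivity, fun v t ht hv => (h v).trans ?_⟩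
  have h1 : v.semi ^ n ≤ A ^ n * Real.exp (n * t) := by
    rw [Real.exp_nat_mul, ← mul_pow]
    exact pow_le_pow_left₀ v.semi_nonneg hv n
  have h2 : 1 ≤ Real.exp (n * t) := Real.one_le_exp (by positivity)
  rw [mul_assoc]
  gcongr
  linarith

lemma exists_half_le_measure_le {α : Type*} [MeasurableSpace α] {P : Measure α}
    [IsProbabilityMeasure P] {g : α → ℝ} (hg : ∀ x, 0 ≤ g x) (hi : Integrable g P) :
    ∃ R : ℝ, 2⁻¹ ≤ P {x | g x ≤ R} := by
  set I := ∫ x, g x ∂P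
  have hI : 0 ≤ I := integral_nonneg hg
  -- Markov's inequality at this level; `I + 1` instead of `I` keeps the level positive when `I =
  -- 0`.
  refine ⟨2 * (I + 1), ?_⟩
  have h1 := mul_meas_ge_le_integral_of_nonneg (.of_forall hg) hi (2 * (I + 1))
  have h2 : P.real {x | 2 * (I + 1) ≤ g x} ≤ 1 / 2 := by
    rw [le_div_iff₀ two_pos]
    nlinarith [measureReal_nonneg (μ := P) (s := {x | 2 * (I + 1) ≤ g x})]
  have h3 : 1 ≤ P.real {x | g x ≤ 2 * (I + 1)} + P.real {x | 2 * (I + 1) ≤ g x} := by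
    refine (probReal_univ (μ := P)).symm.le.trans
      ((measureReal_mono ?_).trans (measureReal_union_le _ _))
    intro x _
    exact le_total (g x) (2 * (I + 1))
  have h4 : 2⁻¹ ≤ P.real {x | g x ≤ 2 * (I + 1)} := by norm_num at h2 ⊢; linarith
  have := ENNReal.ofReal_le_ofReal h4
  rwa [ofReal_measureReal, ENNReal.ofReal_inv_of_pos two_pos, ENNReal.ofReal_ofNat] at this

/-- The functional of the finite element solution has moments bounded uniformly over all
triangulations, and the likelihood is bounded below with probability at least `1/2`. -/
lemma exists_uniform_bounds (hd : 1 ≤ d) {S : Prior D} (hS : S.Admissible) (f : H10 D →L[ℝ] ℝ)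
    {m : ℕ} {H : H10 D → EuclideanSpace ℝ (Fin m)} {φ : H10 D → ℝ} (hφ : PolyGrowth φ)
    (hH : PolyGrowth H) (y : EuclideanSpace ℝ (Fin m)) {s : ℝ} (hs : 0 < s) {r : ℝ} (hr : 1 ≤ r) :
    ∃ (I : ℝ≥0∞) (δ : ℝ), I ≠ ⊤ ∧ 0 < δ ∧ δ ≤ 1 ∧ ∀ T : Triangulation D,
      ∫⁻ ξ, ENNReal.ofReal (|φ (feSolution T f (S.coeff ξ))| ^ r) ∂S.law ≤ I ∧
      2⁻¹ ≤ S.law {ξ | δ ≤ likelihood H y s (feSolution T f (S.coeff ξ))} := by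
  obtain ⟨-, -, τ, hτ0, hτ, hlow⟩ := Prior.exists_coeff_bounds hS
  obtain ⟨A, hA0, hA⟩ := exists_semi_feSolution_le (D := D) hd f
  obtain ⟨B, n, hB0, hB⟩ := hφ.exists_le hA0
  obtain ⟨B', n', hB'0, hB'⟩ := hH.exists_le hA0
  -- The event `exp (n' τ) ≤ R` does not involve the triangulation. On it `‖H(p_h)‖ ≤ B' R` almost
  -- surely, for every `T`, which yields the `δ` below.
  obtain ⟨R, hR⟩ := exists_half_le_measure_le (P := S.law) (fun ξ => (Real.exp_pos _).le) (hτ n')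
  have hsemi : ∀ᵐ ξ ∂S.law, ∀ T : Triangulation D,
      (feSolution T f (S.coeff ξ)).semi ≤ A * Real.exp (τ ξ) := by
    filter_upwards [hlow] with ξ hξ T
    have := hA T _ _ (Real.exp_pos _) hξ
    rwa [Real.exp_neg, div_inv_eq_mul] at this
  refine ⟨∫⁻ ξ, ENNReal.ofReal (B ^ r * Real.exp (n * r * τ ξ)) ∂S.law,
    Real.exp (-(1 / (2 * s) * (‖y‖ + B' * R) ^ 2)), ?_, Real.exp_pos _,
    Real.exp_le_one_iff.2 (neg_nonpos.2 (by positivity)), fun T => ⟨?_, ?_⟩⟩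
  · exact ((hτ (n * r)).const_mul (B ^ r)).lintegral_lt_top.ne
  · refine lintegral_mono_ae ?_
    filter_upwards [hsemi] with ξ hξ
    refine ENNReal.ofReal_le_ofReal ?_
    refine (Real.rpow_le_rpow (abs_nonneg _) (hB _ _ (hτ0 ξ) (hξ T)) (by linarith)).trans_eq ?_
    rw [Real.mul_rpow hB0 (Real.exp_pos _).le, ← Real.exp_mul]
    ring_nf
  · refine hR.trans (measure_mono_ae ?_)
    filter_upwards [hsemi] with ξ hξ (hle : Real.exp (n' * τ ξ) ≤ R)
    have h1 : ‖H (feSolution T f (S.coeff ξ))‖ ≤ B' * R :=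
      (hB' _ _ (hτ0 ξ) (hξ T)).trans (mul_le_mul_of_nonneg_left hle hB'0)
    refine Real.exp_le_exp.2 (neg_le_neg ?_)
    gcongr
    exact (norm_sub_le _ _).trans (by gcongr)

lemma likelihood_pos {m : ℕ} (H : H10 D → EuclideanSpace ℝ (Fin m))
    (y : EuclideanSpace ℝ (Fin m)) (s : ℝ) (v : H10 D) : 0 < likelihood H y s v :=
  Real.exp_pos _

lemma likelihood_le_one {m : ℕ} (H : H10 D → EuclideanSpace ℝ (Fin m))
    (y : EuclideanSpace ℝ (Fin m)) {s : ℝ} (hs : 0 < s) (v : H10 D) : likelihood H y s v ≤ 1 :=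
  Real.exp_le_one_iff.2 (neg_nonpos.2 (by positivity))

lemma qHat_div_zHat {S : Prior D} {f : H10 D →L[ℝ] ℝ} {T : Triangulation D} {m : ℕ}
    {H : H10 D → EuclideanSpace ℝ (Fin m)} {y : EuclideanSpace ℝ (Fin m)} {s : ℝ}
    {φ : H10 D → ℝ} {N : ℕ} (hN : 1 ≤ N) (ξ : Fin N → ℕ → ℝ) :
    qHat S f T H y s φ ξ / zHat S f T H y s ξ
      = (∑ i, likelihood H y s (feSolution T f (S.coeff (ξ i))) *
          φ (feSolution T f (S.coeff (ξ i)))) /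
        ∑ i, likelihood H y s (feSolution T f (S.coeff (ξ i))) := by
  have : (1 / (N : ℝ)) ≠ 0 := by positivity
  exact mul_div_mul_left _ _ this

lemma eLpNorm_le_of_lintegral_ofReal_le {α : Type*} [MeasurableSpace α] {μ : Measure α}
    {g : α → ℝ} {r : ℝ≥0∞} (hr : 1 ≤ r) (hr' : r ≠ ⊤) {K : ℝ≥0∞}
    (h : ∫⁻ x, ENNReal.ofReal (|g x| ^ r.toReal) ∂μ ≤ K) :
    eLpNorm g r μ ≤ K ^ (1 / r.toReal) := by
  rw [eLpNorm_eq_lintegral_rpow_enorm_toReal (zero_lt_one.trans_le hr).ne' hr']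
  refine ENNReal.rpow_le_rpow ((lintegral_congr fun x => ?_).trans_le h) (by positivity)
  rw [Real.enorm_eq_ofReal_abs, ENNReal.ofReal_rpow_of_nonneg (abs_nonneg _) (by positivity)]

end RatioMC

end

open RatioMC
theorem lemma4p3 {d : ℕ} (hd : 1 ≤ d) (D : BoundedDomain d)
    (S : Prior D) (hS : S.Admissible)
    (f : H10 D →L[ℝ] ℝ)
    {m : ℕ} (H : H10 D → EuclideanSpace ℝ (Fin m)) (φ : H10 D → ℝ)
    (hHmeas : Measurable[borel (H10 D)] H) (hφmeas : Measurable[borel (H10 D)] φ)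
    (hφ : PolyGrowth φ) (hH : PolyGrowth H)
    (y : EuclideanSpace ℝ (Fin m)) (s : ℝ) (hs : 0 < s)
    (r : ℝ≥0∞) (hr : 1 ≤ r) (hr' : r ≠ ⊤) :
    ∃ C : ℝ, ∀ (T : Triangulation D) (N : ℕ), 1 ≤ N →
      ∀ (Ω : Type*) [MeasurableSpace Ω] (μ : Measure Ω) [IsProbabilityMeasure μ]
        (ξ : Fin N → Ω → ℕ → ℝ),
        (∀ i, HasLaw (ξ i) S.law μ) → iIndepFun ξ μ →
        MemLp (fun ω => qHat S f T H y s φ (fun i => ξ i ω) / zHat S f T H y s (fun i => ξ i ω))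
            r μ ∧
          eLpNorm
            (fun ω => qHat S f T H y s φ (fun i => ξ i ω) / zHat S f T H y s (fun i => ξ i ω))
            r μ ≤ ENNReal.ofReal C := by
  have hr1 : 1 ≤ r.toReal := by
    rw [← ENNReal.toReal_one]
    exact ENNReal.toReal_mono hr' hr
  obtain ⟨I, δ, hI, hδ, hδ1, hb⟩ := exists_uniform_bounds hd hS f hφ hH y hs hr1
  set K : ℝ≥0∞ := (ENNReal.ofReal δ⁻¹ * 2 * I) ^ (1 / r.toReal) with hK
  have hKtop : K ≠ ⊤ :=
    ENNReal.rpow_ne_top_of_nonneg (by positivity)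
      (ENNReal.mul_ne_top (ENNReal.mul_ne_top ENNReal.ofReal_ne_top (by simp)) hI)
  refine ⟨K.toReal, fun T N hN Ω _ μ _ ξ hξ hind => ?_⟩
  rw [ENNReal.ofReal_toReal hKtop]
  simp only [qHat_div_zHat hN]
  have hp := aestronglyMeasurable_feSolution hd hS f T
  have hφm : AEMeasurable (fun x => φ (feSolution T f (S.coeff x))) S.law :=
    aemeasurable_comp_of_borel hp hφmeas
  have hHm : AEMeasurable (fun x => H (feSolution T f (S.coeff x))) S.law :=
    aemeasurable_comp_of_borel hp hHmeas
  have hθm : AEMeasurable (fun x => likelihood H y s (feSolution T f (S.coeff x))) S.law := by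
    have hc : Continuous fun z => Real.exp (-(1 / (2 * s) * ‖y - z‖ ^ 2)) := by fun_prop
    exact hc.measurable.comp_aemeasurable hHm
  have hle := eLpNorm_le_of_lintegral_ofReal_le hr hr' <|
    (lintegral_ratio_rpow_le hθm hφm (fun _ => likelihood_pos H y s _)
      (fun _ => likelihood_le_one H y hs _) hδ hδ1 (hb T).2 hr1 hN hξ hind).trans
        (mul_le_mul_right (hb T).1 _)
  refine ⟨⟨?_, hle.trans_lt hKtop.lt_top⟩, hle⟩
  -- Almost everywhere measurability is known only under the prior; it transfers to the samples
  -- because each has that law.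
  have hcomp : ∀ g : (ℕ → ℝ) → ℝ, AEMeasurable g S.law → ∀ i,
      AEMeasurable (fun ω => g (ξ i ω)) μ := fun g hg i => by
    rw [← (hξ i).map_eq] at hg
    exact hg.comp_aemeasurable (hξ i).aemeasurable
  exact ((Finset.aemeasurable_fun_sum _ fun i _ => (hcomp _ hθm i).mul (hcomp _ hφm i)).div
    (Finset.aemeasurable_fun_sum _ fun i _ => hcomp _ hθm i)).aestronglyMeasurable
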